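/- Let $(\Omega,\mathcal F,\mathbb P)$ be a probability space with an ergodic, invertible (bimeasurable) measure-preserving transformation $T$, and let $T_j=T^j$ for $j\in\mathbb Z$. Let $V:\Omega\to[0,1]$ be measurable with essential infimum $0$ and essential supremum $1$ under $\mathbb P$, and let $\beta>0$. Let $E_0$ be the expectation of simple symmetric random walk $(X_i)_{i\ge0}$ on $\mathbb Z$ started at $0$, and $\tau_1=\inf\{i\ge0:X_i=1\}$. The tilted free energy is the deterministic limit $$\Lambda_\beta(\theta)=\lim_{n\to\infty}\frac1n\log E_0\Big[e^{\beta\sum_{i=0}^{n-1}V(T_{X_i}\omega)+\theta X_n}\Big]\qquad\text{for }\mathbb P\text{-a.e. }\omega,\quad \theta\in\mathbb R,$$ and $\theta_b=\sup\{\theta\in\mathbb R:\Lambda_\beta(\theta)=\beta\}$. For $\theta>0$ with $\Lambda_\beta(\theta)>\beta$ put $$F_{\beta,\theta}(\omega,1)=-\log E_0\Big[e^{\beta\sum_{i=0}^{\tau_1-1}V(T_{X_i}\omega)-\Lambda_\beta(\theta)\tau_1}\mathbf 1_{\{\tau_1<\infty\}}\Big]-\theta,\qquad q_{\beta,\theta}(\omega)=\tfrac12e^{\beta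 V(\omega)+\theta+F_{\beta,\theta}(\omega,1)-\Lambda_\beta(\theta)},$$ $$r_{\beta,\theta}=\frac{1-q_{\beta,\theta}}{q_{\beta,\theta}},\qquad S_{\beta,\theta}(\omega)=1+\sum_{n=1}^\infty\prod_{j=1}^nr_{\beta,\theta}(T_j\omega),\qquad \bar r_\beta(\omega)=\tfrac12\big[e^{\beta(V(\omega)-1)}+1\big].$$ **Proposition.** Suppose that $(V(T_j\omega))_{j\in\mathbb Z}$ are i.i.d. under $\mathbb P$. Then the limit defining $\Lambda_\beta(\theta)$ exists for every $\theta\in\mathbb R$, $0<\theta_b=\inf\{\theta>0:\Lambda_\beta(\theta)>\beta\}<\infty$ (so $\theta_b$ is well defined, with the set in its definition nonempty and bounded above), and $\mathbb E[\bar r_\beta]<1$. For every $\theta>\theta_b$ one has $\Lambda_\beta(\theta)>\beta$, the series $S_{\beta,\theta}(\omega)$ converges for every $\omega$, $(1+r_{\beta,\theta})S_{\beta,\theta}$ is integrable, and $$\mathbb E\big[(1+r_{\beta,\theta})S_{\beta,\theta}\big]\le\frac{1+\mathbb E[\bar r_\beta]}{1-\mathbb E[\bar r_\beta]}<\infty .$$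 Moreover, $\theta\mapsto\Lambda_\beta(\theta)$ is not differentiable at $\theta_b$ and not differentiable at $-\theta_b$. -/

import Mathlib

open MeasureTheory ProbabilityTheory Filter Topology

noncomputable section

namespace TiltedWalk

/-- The step `+1` or `-1` encoded by a fair coin toss. -/
def step (b : Bool) : ℤ := if b then 1 else -1

/-- The position at time `n` of the nearest-neighbour walk on `ℤ` that starts at `0` and uses the
coin tosses `s`. -/
def walk (s : ℕ → Bool) (n : ℕ) : ℤ := ∑ i ∈ Finset.range n, step (s i)

/-- The law of the coin tosses: independent and fair. Under it `walk` is the simple symmetric random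
walk on `ℤ` started at `0`, and integrals against it are the expectation `E₀`. -/
def coinLaw : Measure (ℕ → Bool) :=
  Measure.infinitePi fun _ : ℕ => (PMF.uniformOfFintype Bool).toMeasure

/-- The first time at which the walk is at `k` (`⊤` if it never is). -/
def hitTime (k : ℤ) (s : ℕ → Bool) : ℕ∞ := ⨅ (i : ℕ) (_ : walk s i = k), (i : ℕ∞)

variable {Ω : Type*} [MeasurableSpace Ω]

/-- The iterates `T_j`, `j ∈ ℤ`, of the invertible transformation `T`. -/
def shift (T : Ω ≃ᵐ Ω) (j : ℤ) (ω : Ω) : Ω := ((T.toEquiv : Equiv.Perm Ω) ^ j) ω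

/-- The path sum `∑_{i < n} V(T_{X_i} ω)`. -/
def pathSum (T : Ω ≃ᵐ Ω) (V : Ω → ℝ) (ω : Ω) (s : ℕ → Bool) (n : ℕ) : ℝ :=
  ∑ i ∈ Finset.range n, V (shift T (walk s i) ω)

/-- `E₀[exp(β ∑_{i < n} V(T_{X_i} ω) + θ X_n)]`. -/
def partitionFn (T : Ω ≃ᵐ Ω) (V : Ω → ℝ) (β θ : ℝ) (n : ℕ) (ω : Ω) : ℝ :=
  ∫ s, Real.exp (β * pathSum T V ω s n + θ * (walk s n : ℝ)) ∂coinLaw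

/-- `ℓ` is the almost sure limit of `(1/n) log E₀[exp(β ∑_{i < n} V(T_{X_i} ω) + θ X_n)]`. -/
def IsTiltedFreeEnergy (P : Measure Ω) (T : Ω ≃ᵐ Ω) (V : Ω → ℝ) (β θ ℓ : ℝ) : Prop :=
  ∀ᵐ ω ∂P, Tendsto (fun n : ℕ => (1 / (n : ℝ)) * Real.log (partitionFn T V β θ n ω))
    atTop (𝓝 ℓ)

open Classical in
/-- The tilted free energy `Λ_β(θ)`: the deterministic almost sure limit above
(and `0` if there is no such limit). -/
def freeEnergy (P : Measure Ω) (T : Ω ≃ᵐ Ω) (V : Ω → ℝ) (β θ : ℝ) : ℝ :=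
  if h : ∃ ℓ : ℝ, IsTiltedFreeEnergy P T V β θ ℓ then h.choose else 0

/-- The right endpoint `θ_b` of `{θ : Λ_β(θ) = β}`. -/
def thetaB (P : Measure Ω) (T : Ω ≃ᵐ Ω) (V : Ω → ℝ) (β : ℝ) : ℝ :=
  sSup {θ : ℝ | freeEnergy P T V β θ = β}

/-- `E₀[exp(β ∑_{i < τ₁} V(T_{X_i} ω) - lam τ₁) ; τ₁ < ∞]`. -/
def passageFn (T : Ω ≃ᵐ Ω) (V : Ω → ℝ) (β lam : ℝ) (ω : Ω) : ℝ :=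
  ∫ s, (if hitTime 1 s = ⊤ then 0 else
    Real.exp (β * pathSum T V ω s (hitTime 1 s).toNat - lam * ((hitTime 1 s).toNat : ℝ)))
    ∂coinLaw

/-- The corrector `F_{β,θ}(ω, 1)`, for `θ > 0` with `Λ_β(θ) > β`. -/
def corrector (P : Measure Ω) (T : Ω ≃ᵐ Ω) (V : Ω → ℝ) (β θ : ℝ) (ω : Ω) : ℝ :=
  -Real.log (passageFn T V β (freeEnergy P T V β θ) ω) - θ

/-- The probability `q_{β,θ}(ω)` of jumping to the right. -/
def jumpRight (P : Measure Ω) (T : Ω ≃ᵐ Ω) (V : Ω → ℝ) (β θ : ℝ) (ω : Ω) : ℝ :=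
  1 / 2 * Real.exp (β * V ω + θ + corrector P T V β θ ω - freeEnergy P T V β θ)

/-- The ratio `r_{β,θ}(ω) = (1 - q_{β,θ}(ω)) / q_{β,θ}(ω)`. -/
def ratio (P : Measure Ω) (T : Ω ≃ᵐ Ω) (V : Ω → ℝ) (β θ : ℝ) (ω : Ω) : ℝ :=
  (1 - jumpRight P T V β θ ω) / jumpRight P T V β θ ω

/-- The product `∏_{j=1}^n r_{β,θ}(T_j ω)`. -/
def ratioProd (P : Measure Ω) (T : Ω ≃ᵐ Ω) (V : Ω → ℝ) (β θ : ℝ) (n : ℕ) (ω : Ω) : ℝ :=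
  ∏ j ∈ Finset.Icc 1 n, ratio P T V β θ (shift T (j : ℤ) ω)

/-- `S_{β,θ}(ω) = 1 + ∑_{n ≥ 1} ∏_{j=1}^n r_{β,θ}(T_j ω)`. -/
def ratioSeries (P : Measure Ω) (T : Ω ≃ᵐ Ω) (V : Ω → ℝ) (β θ : ℝ) (ω : Ω) : ℝ :=
  1 + ∑' n : ℕ, ratioProd P T V β θ (n + 1) ω

/-- `r̄_β(ω) = (exp(β (V(ω) - 1)) + 1) / 2`. -/
def rBar (V : Ω → ℝ) (β : ℝ) (ω : Ω) : ℝ := 1 / 2 * (Real.exp (β * (V ω - 1)) + 1)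

end TiltedWalk

end

/-!
The free energy is computed by inverting a growth rate. For `lam ≥ β`, the continued fraction
`u = a / (1 - a u(T⁻¹ ω))` with `a = exp (β V - lam) / 2` (`leftFrac`) is the weight of all paths
from `0` to `1`, and the function on `ℤ` with `h 0 = 1` and `h (x + 1) = h x / u(T_x ω)` is harmonic
for the walk with the weight `exp (β V - lam)` per step (`transfer_expSum`). Hence
`E₀[exp (∑ (β V - lam)) h(X_n)] = 1` for all `n`. By the ergodic theorem
(`ae_abs_birkhoffSum_sub_le`), `h x = exp (g x + o(|x|))` in both directions, where
`g = growthRate lam` is the mean of `-log u`. So the free energy at the tilt `g` exists and equals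
`lam` (`isTiltedFreeEnergy_growthRate`). The same argument for `T⁻¹` gives the free energy at the
tilt `-g`, because an i.i.d. environment and its reversal have the same law (`growthRate_symm`).

Since `u` at `lam + h` is at most `exp (-h)` times `u` at `lam`, the growth rate increases at least
with slope `1`. In the other direction, the increments of `-log u` satisfy an affine recursion along
the orbit, whose factor is dominated by `rBar`; by independence the iterated recursion has the
expectation of a geometric series, and the growth rate is Lipschitz with the constant
`K = (1 + E rBar) / (1 - E rBar)` (`growthRate_add_sub_le`). It therefore maps `[β, ∞)` onto
`[t, ∞)`, where `t = growthRate β` is positive, and the free energy on `[t, ∞)` is its inverse,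
with slopes at least `1 / K`.

For a tilt in `[-t, t]`, the free energy is at most `β` by comparison with the tilts `±t`. It is at
least `β` because almost every environment has arbitrarily long stretches where `V` is almost `1`
(`ae_exists_stretch`): over such a stretch a parabola is subharmonic for the weight with any
`lam < β` (`linear_lower_bound_of_stretch`). So the free energy is constant on `[-t, t]`, `t` is
`thetaB`, and there are kinks at `±t`.

Finally, for `lam > β` optional stopping identifies `passageFn` with `u` (`integral_prod_hitTime`).
This gives `r = u(ω) u(T⁻¹ ω) ≤ min (exp (-(lam - β))) rBar`, from which the convergence of the
series and, again by independence, the bound on its expectation follow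
(`integrable_ratioSeries_and_integral_le`).
-/

noncomputable section

namespace TiltedWalk

/-! ### The coin measure and path expectations -/

instance : IsProbabilityMeasure coinLaw := by unfold coinLaw; infer_instance

/-- Relabelling the two faces of each coin does not change the law of the tosses. -/
lemma measurePreserving_relabel (e : ℕ → Equiv.Perm Bool) :
    MeasurePreserving (fun (s : ℕ → Bool) i => e i (s i)) coinLaw coinLaw := by
  refine ⟨by fun_prop, ?_⟩
  unfold coinLaw
  rw [Measure.infinitePi_map_pi _ (fun i => by fun_prop)]
  congr 1
  funext i
  refine Measure.ext_of_singleton fun b => ?_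
  rw [Measure.map_apply (by fun_prop) (by measurability)]
  have : (e i) ⁻¹' {b} = {(e i).symm b} := by ext; simp [Equiv.eq_symm_apply]
  rw [this, PMF.toMeasure_apply_singleton _ _ (by measurability),
    PMF.toMeasure_apply_singleton _ _ (by measurability)]
  simp

/-- Reverse the toss with index `n`. -/
def flipAt (n : ℕ) (s : ℕ → Bool) : ℕ → Bool := fun i => if i = n then !s i else s i

lemma measurePreserving_flipAt (n : ℕ) : MeasurePreserving (flipAt n) coinLaw coinLaw := by
  convert measurePreserving_relabel (fun i => if i = n then Equiv.boolNot else Equiv.refl _) using 1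
  funext s i
  by_cases h : i = n <;> simp [flipAt, h]

/-- Averaging over one toss: an integral equals the integral of the mean over the two values of the
toss with index `n`. -/
lemma integral_eq_average_flipAt (n : ℕ) {G : (ℕ → Bool) → ℝ} (hG : Integrable G coinLaw) :
    ∫ s, G s ∂coinLaw = ∫ s, (G s + G (flipAt n s)) / 2 ∂coinLaw := by
  have h := measurePreserving_flipAt n
  have hG' : Integrable (fun s => G (flipAt n s)) coinLaw := by
    have := h.integrable_comp hG.aestronglyMeasurable
    exact this.2 hG
  have h2 : ∫ s, G (flipAt n s) ∂coinLaw = ∫ s, G s ∂coinLaw := by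
    have := integral_map (μ := coinLaw) (φ := flipAt n) (f := G) h.measurable.aemeasurable
      (by rw [h.map_eq]; exact hG.aestronglyMeasurable)
    rw [h.map_eq] at this
    exact this.symm
  rw [integral_div, integral_add hG hG', h2]
  ring

lemma walk_zero (s : ℕ → Bool) : walk s 0 = 0 := by simp [walk]

lemma walk_succ (s : ℕ → Bool) (n : ℕ) : walk s (n + 1) = walk s n + step (s n) := by
  simp [walk, Finset.sum_range_succ]

lemma walk_flipAt {i n : ℕ} (h : i ≤ n) (s : ℕ → Bool) : walk (flipAt n s) i = walk s i := by
  unfold walk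
  refine Finset.sum_congr rfl fun j hj => ?_
  have : j ≠ n := by have := Finset.mem_range.1 hj; omega
  simp [flipAt, this]

lemma measurable_walk (n : ℕ) : Measurable fun s : ℕ → Bool => walk s n := by
  unfold walk
  refine Finset.measurable_sum _ fun i _ => ?_
  exact (measurable_of_finite step).comp (measurable_pi_apply i)

lemma abs_walk_le (s : ℕ → Bool) (n : ℕ) : |walk s n| ≤ n := by
  induction n with
  | zero => simp [walk_zero]
  | succ n ih =>
    rw [walk_succ]
    have : |step (s n)| ≤ 1 := by unfold step; split_ifs <;> simp
    push_cast
    exact (abs_add_le _ _).trans (by linarith)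

lemma add_apply_flipAt (φ : ℤ → ℝ) (n : ℕ) (s : ℕ → Bool) :
    φ (walk s (n + 1)) + φ (walk (flipAt n s) (n + 1)) =
      φ (walk s n + 1) + φ (walk s n - 1) := by
  rw [walk_succ, walk_succ, walk_flipAt le_rfl]
  cases h : s n
  · simp [flipAt, step, h, sub_eq_add_neg, add_comm]
  · simp [flipAt, step, h, sub_eq_add_neg]

lemma exists_bound_walk (φ : ℤ → ℝ) (n : ℕ) : ∃ C, ∀ s, |φ (walk s n)| ≤ C := by
  obtain ⟨C, hC⟩ := ((Set.finite_Icc (-n : ℤ) n).image fun x => |φ x|).bddAbove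
  exact ⟨C, fun s => hC ⟨_, abs_le.1 (abs_walk_le s n), rfl⟩⟩

lemma exists_bound_prod_walk (b : ℤ → ℝ) (n : ℕ) :
    ∃ C, ∀ s, |∏ i ∈ Finset.range n, b (walk s i)| ≤ C := by
  induction n with
  | zero => exact ⟨1, by simp⟩
  | succ n ih =>
    obtain ⟨C, hC⟩ := ih
    obtain ⟨D, hD⟩ := exists_bound_walk b n
    refine ⟨C * D, fun s => ?_⟩
    rw [Finset.prod_range_succ, abs_mul]
    exact mul_le_mul (hC s) (hD s) (abs_nonneg _) ((abs_nonneg _).trans (hC s))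

lemma measurable_prod_walk (b : ℤ → ℝ) (n : ℕ) :
    Measurable fun s => ∏ i ∈ Finset.range n, b (walk s i) :=
  Finset.measurable_prod _ fun i _ => (measurable_of_countable b).comp (measurable_walk i)

lemma integrable_prod_walk_mul (b h : ℤ → ℝ) (n : ℕ) :
    Integrable (fun s => (∏ i ∈ Finset.range n, b (walk s i)) * h (walk s n)) coinLaw := by
  obtain ⟨C, hC⟩ := exists_bound_prod_walk b n
  obtain ⟨D, hD⟩ := exists_bound_walk h n
  refine Integrable.of_bound (C := C * D) ?_ (Eventually.of_forall fun s => ?_)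
  · exact ((measurable_prod_walk b n).mul
      ((measurable_of_countable h).comp (measurable_walk n))).aestronglyMeasurable
  · rw [Real.norm_eq_abs, abs_mul]
    exact mul_le_mul (hC s) (hD s) (abs_nonneg _) ((abs_nonneg _).trans (hC s))

/-- The transition operator of simple random walk weighted by `b`. -/
def transfer (b h : ℤ → ℝ) : ℤ → ℝ := fun x => b x * ((h (x + 1) + h (x - 1)) / 2)

/-- The Feynman–Kac formula. -/
lemma integral_prod_walk_mul (b h : ℤ → ℝ) (n : ℕ) :
    ∫ s, (∏ i ∈ Finset.range n, b (walk s i)) * h (walk s n) ∂coinLaw =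
      (transfer b)^[n] h 0 := by
  induction n generalizing h with
  | zero => simp [walk_zero]
  | succ n ih =>
    rw [Function.iterate_succ_apply, ← ih,
      integral_eq_average_flipAt n (integrable_prod_walk_mul b h (n + 1))]
    congr 1
    funext s
    have : ∏ i ∈ Finset.range (n + 1), b (walk (flipAt n s) i) =
        ∏ i ∈ Finset.range (n + 1), b (walk s i) :=
      Finset.prod_congr rfl fun i hi => by
        rw [walk_flipAt (Nat.lt_succ_iff.1 (Finset.mem_range.1 hi))]
    rw [this, ← mul_add, add_apply_flipAt, Finset.prod_range_succ, transfer]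
    ring

/-! ### The pointwise ergodic theorem for bounded functions -/

section Birkhoff

variable {Ω : Type*}

/-- The largest of the Birkhoff sums of orders `1, …, n + 1`. -/
def maxBirkhoff (T : Ω → Ω) (f : Ω → ℝ) : ℕ → Ω → ℝ
  | 0, ω => f ω
  | n + 1, ω => f ω + max 0 (maxBirkhoff T f n (T ω))

variable {T : Ω → Ω} {f : Ω → ℝ}

lemma birkhoffSum_le_maxBirkhoff (n : ℕ) (ω : Ω) :
    ∀ k ≤ n, birkhoffSum T f (k + 1) ω ≤ maxBirkhoff T f n ω := by
  induction n generalizing ω with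
  | zero => intro k hk; obtain rfl : k = 0 := by omega
            simp [maxBirkhoff]
  | succ n ih =>
    intro k hk
    rw [birkhoffSum_succ', maxBirkhoff]
    gcongr
    rcases k with _ | k
    · simp
    · exact (ih (T ω) k (by omega)).trans (le_max_right _ _)

lemma maxBirkhoff_le_succ (n : ℕ) (ω : Ω) : maxBirkhoff T f n ω ≤ maxBirkhoff T f (n + 1) ω := by
  induction n generalizing ω with
  | zero => simp [maxBirkhoff]
  | succ n ih => rw [maxBirkhoff, maxBirkhoff]; gcongr; exact ih _

lemma abs_maxBirkhoff_le {C : ℝ} (hC : ∀ ω, |f ω| ≤ C) (n : ℕ) (ω : Ω) :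
    |maxBirkhoff T f n ω| ≤ (n + 1) * C := by
  induction n generalizing ω with
  | zero => simpa [maxBirkhoff] using hC ω
  | succ n ih =>
    rw [maxBirkhoff]
    refine (abs_add_le _ _).trans ?_
    have h1 : |max 0 (maxBirkhoff T f n (T ω))| ≤ |maxBirkhoff T f n (T ω)| := by
      rw [abs_of_nonneg (le_max_left _ _)]
      exact max_le (abs_nonneg _) (le_abs_self _)
    have := ih (T ω)
    have := hC ω
    push_cast
    linarith

variable [MeasurableSpace Ω] {P : Measure Ω} [IsProbabilityMeasure P]

lemma measurable_maxBirkhoff (hT : Measurable T) (hf : Measurable f) (n : ℕ) :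
    Measurable (maxBirkhoff T f n) := by
  induction n with
  | zero => exact hf
  | succ n ih => exact hf.add (measurable_const.max (ih.comp hT))

/-- If `f` has negative mean, its Birkhoff sums are almost surely bounded above. On the invariant
set where they are not, the increments of the running maximum of the sums along the orbit decrease
to `f`, while their integrals are nonnegative. -/
lemma ae_bddAbove_birkhoffSum (hT : Ergodic T P) (hf : Measurable f) {C : ℝ}
    (hC : ∀ ω, |f ω| ≤ C) (hneg : ∫ ω, f ω ∂P < 0) :
    ∀ᵐ ω ∂P, ∃ B, ∀ n, birkhoffSum T f n ω ≤ B := by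
  have hTm := hT.measurable
  have hmeas := measurable_maxBirkhoff (f := f) hTm hf
  set A : Set Ω := {ω | ∀ B : ℕ, ∃ n, (B : ℝ) < maxBirkhoff T f n ω} with hA
  have hAm : MeasurableSet A := by
    have : A = ⋂ B : ℕ, ⋃ n, {ω | (B : ℝ) < maxBirkhoff T f n ω} := by ext; simp [hA]
    rw [this]
    exact MeasurableSet.iInter fun B => MeasurableSet.iUnion fun n =>
      measurableSet_lt measurable_const (hmeas n)
  have hAinv : T ⁻¹' A = A := by
    ext ω
    constructor
    · intro h B
      obtain ⟨k, hk⟩ := exists_nat_ge C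
      obtain ⟨n, hn⟩ := h (B + k)
      refine ⟨n + 1, ?_⟩
      rw [maxBirkhoff]
      push_cast at hn
      have := le_max_right 0 (maxBirkhoff T f n (T ω))
      linarith [(abs_le.1 (hC ω)).1]
    · intro h B
      obtain ⟨k, hk⟩ := exists_nat_ge C
      obtain ⟨n, hn⟩ := h (B + k)
      have hn' := hn.trans_le (maxBirkhoff_le_succ n ω)
      refine ⟨n, ?_⟩
      rw [maxBirkhoff] at hn'
      push_cast at hn'
      have h1 : (B : ℝ) < max 0 (maxBirkhoff T f n (T ω)) := by
        linarith [(abs_le.1 (hC ω)).2]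
      rcases lt_max_iff.1 h1 with h2 | h2
      · exact absurd h2 (not_lt.2 (Nat.cast_nonneg B))
      · exact h2
  have hint : ∀ n, Integrable (maxBirkhoff T f n) P := fun n =>
    Integrable.of_bound (hmeas n).aestronglyMeasurable ((n + 1) * C)
      (Eventually.of_forall fun ω => abs_maxBirkhoff_le hC n ω)
  have hkey : 0 ≤ ∫ ω in A, f ω ∂P := by
    have hlim : Tendsto
        (fun n => ∫ ω in A, (maxBirkhoff T f (n + 1) ω - maxBirkhoff T f n (T ω)) ∂P) atTop
        (𝓝 (∫ ω in A, f ω ∂P)) := by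
      refine tendsto_integral_of_dominated_convergence (fun _ => 2 * C) ?_
        (integrable_const _) ?_ ?_
      · exact fun n => ((hmeas _).sub ((hmeas n).comp hTm)).aestronglyMeasurable
      · refine fun n => Eventually.of_forall fun ω => ?_
        have h1 : -C ≤ maxBirkhoff T f n (T ω) := by
          have := birkhoffSum_le_maxBirkhoff (f := f) (T := T) n (T ω) 0 (Nat.zero_le _)
          simp at this
          linarith [(abs_le.1 (hC (T ω))).1]
        have h2 := abs_le.1 (hC ω)
        rw [maxBirkhoff, Real.norm_eq_abs, abs_le]
        rcases max_cases 0 (maxBirkhoff T f n (T ω)) with h | h <;> constructor <;> linarith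
      · refine (ae_restrict_iff' hAm).2 (Eventually.of_forall fun ω hω => ?_)
        rw [← hAinv] at hω
        obtain ⟨N, hN⟩ := hω 0
        refine tendsto_const_nhds.congr' ?_
        filter_upwards [eventually_ge_atTop N] with n hn
        have hmono : Monotone fun n => maxBirkhoff T f n (T ω) :=
          monotone_nat_of_le_succ fun n => maxBirkhoff_le_succ n _
        have : 0 < maxBirkhoff T f n (T ω) := by
          have := hmono hn
          simp only at this
          push_cast at hN
          linarith
        rw [maxBirkhoff, max_eq_right this.le]
        ring
    refine ge_of_tendsto hlim (Eventually.of_forall fun n => ?_)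
    have hcomp : ∫ ω in A, maxBirkhoff T f n (T ω) ∂P = ∫ ω in A, maxBirkhoff T f n ω ∂P := by
      have h := hT.toMeasurePreserving.restrict_preimage hAm
      rw [hAinv] at h
      have := integral_map (μ := P.restrict A) (φ := T) (f := maxBirkhoff T f n)
        hTm.aemeasurable (hmeas n).aestronglyMeasurable
      rw [h.map_eq] at this
      exact this.symm
    have hintT : Integrable (fun ω => maxBirkhoff T f n (T ω)) P :=
      (hT.toMeasurePreserving.integrable_comp (hmeas n).aestronglyMeasurable).2 (hint n)
    rw [integral_sub (hint _).integrableOn hintT.integrableOn, hcomp,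
      ← integral_sub (hint _).integrableOn (hint _).integrableOn]
    exact integral_nonneg fun ω => sub_nonneg.2 (maxBirkhoff_le_succ n ω)
  have hA0 : P A = 0 := by
    rcases hT.toPreErgodic.prob_eq_zero_or_one hAm hAinv with h | h
    · exact h
    · have hAe : A =ᵐ[P] Set.univ := by
        rw [ae_eq_univ]
        exact (prob_compl_eq_zero_iff hAm).2 h
      rw [setIntegral_congr_set hAe, setIntegral_univ] at hkey
      linarith
  have : ∀ᵐ ω ∂P, ω ∉ A := measure_eq_zero_iff_ae_notMem.1 hA0
  filter_upwards [this] with ω hω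
  simp only [hA, Set.mem_ofPred_eq, not_forall, not_exists, not_lt] at hω
  obtain ⟨B, hB⟩ := hω
  refine ⟨B, fun n => ?_⟩
  rcases n with _ | n
  · simp
  · exact (birkhoffSum_le_maxBirkhoff n ω n le_rfl).trans (hB n)

lemma ae_eventually_birkhoffSum_le (hT : Ergodic T P) (hf : Measurable f) {C : ℝ}
    (hC : ∀ ω, |f ω| ≤ C) :
    ∀ᵐ ω ∂P, ∀ ε > 0, ∃ B, ∀ n : ℕ, birkhoffSum T f n ω ≤ n * (∫ ω, f ω ∂P + ε) + B := by
  have hfi : Integrable f P := Integrable.of_bound hf.aestronglyMeasurable C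
    (Eventually.of_forall hC)
  have h : ∀ k : ℕ, ∀ᵐ ω ∂P, ∃ B, ∀ n, birkhoffSum T
      (fun ω => f ω - (∫ ω, f ω ∂P + 1 / ((k : ℝ) + 1))) n ω ≤ B := fun k => by
    refine ae_bddAbove_birkhoffSum (C := C + |∫ ω, f ω ∂P + 1 / ((k : ℝ) + 1)|) hT
      (hf.sub_const _) (fun ω => ?_) ?_
    · exact (abs_sub _ _).trans (by gcongr; exact hC ω)
    · rw [integral_sub hfi (integrable_const _)]
      have : (0 : ℝ) < 1 / ((k : ℝ) + 1) := by positivity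
      simpa using by positivity
  filter_upwards [ae_all_iff.2 h] with ω hω ε hε
  obtain ⟨k, hk⟩ := exists_nat_one_div_lt hε
  obtain ⟨B, hB⟩ := hω k
  refine ⟨B, fun n => ?_⟩
  have h1 := hB n
  have h2 : birkhoffSum T (fun ω => f ω - (∫ ω, f ω ∂P + 1 / ((k : ℝ) + 1))) n ω =
      birkhoffSum T f n ω - n * (∫ ω, f ω ∂P + 1 / ((k : ℝ) + 1)) := by
    simp [birkhoffSum, Finset.sum_sub_distrib]
    ring
  rw [h2] at h1
  have : (n : ℝ) * (∫ ω, f ω ∂P + 1 / ((k : ℝ) + 1)) ≤ n * (∫ ω, f ω ∂P + ε) := by gcongr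
  linarith

/-- Birkhoff's pointwise ergodic theorem for a bounded function, in the form of an error bound that
holds for all times at once. -/
lemma ae_abs_birkhoffSum_sub_le (hT : Ergodic T P) (hf : Measurable f) {C : ℝ}
    (hC : ∀ ω, |f ω| ≤ C) :
    ∀ᵐ ω ∂P, ∀ ε > 0, ∃ B, ∀ n : ℕ, |birkhoffSum T f n ω - n * ∫ ω, f ω ∂P| ≤ n * ε + B := by
  filter_upwards [ae_eventually_birkhoffSum_le hT hf hC,
    ae_eventually_birkhoffSum_le (f := fun ω => -f ω) hT hf.neg (C := C) (by simpa using hC)]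
    with ω h1 h2 ε hε
  obtain ⟨B, hB⟩ := h1 ε hε
  obtain ⟨D, hD⟩ := h2 ε hε
  refine ⟨max B D, fun n => ?_⟩
  have h3 := hB n
  have h4 := hD n
  have h5 : birkhoffSum T (fun ω => -f ω) n ω = -birkhoffSum T f n ω := by simp [birkhoffSum]
  rw [h5, integral_neg] at h4
  have := le_max_left B D
  have := le_max_right B D
  rw [abs_le]
  constructor <;> nlinarith

end Birkhoff

/-! ### The continued fraction of an environment -/

/-- The weight of one step at a site where the potential has the value `v`. -/
def stepWeight (β lam v : ℝ) : ℝ := 1 / 2 * Real.exp (β * v - lam)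

/-- The approximants of the continued fraction `a₀ / (1 - a₀ a₁ / (1 - a₁ a₂ / ⋯))`, where `a_i` is
the step weight at the `i`-th value of the potential. -/
def contFracApprox (β lam : ℝ) : ℕ → (ℕ → ℝ) → ℝ
  | 0, _ => 0
  | k + 1, v => stepWeight β lam (v 0) /
      (1 - stepWeight β lam (v 0) * contFracApprox β lam k fun i => v (i + 1))

/-- The continued fraction of a one-sided environment, as the supremum of its approximants. It is
the weight of all paths from `0` to `1` when `v i` is the potential at the site `-i`. -/
def contFrac (β lam : ℝ) (v : ℕ → ℝ) : ℝ := ⨆ k, contFracApprox β lam k v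

lemma stepWeight_pos (β lam v : ℝ) : 0 < stepWeight β lam v := by unfold stepWeight; positivity

lemma stepWeight_add (β lam h v : ℝ) :
    stepWeight β (lam + h) v = Real.exp (-h) * stepWeight β lam v := by
  unfold stepWeight
  rw [show β * v - (lam + h) = -h + (β * v - lam) by ring, Real.exp_add]
  ring

lemma measurable_contFrac (β lam : ℝ) : Measurable (contFrac β lam) := by
  refine Measurable.iSup fun k => ?_
  induction k with
  | zero => exact measurable_const
  | succ k ih =>
    have h0 : Measurable fun v : ℕ → ℝ => stepWeight β lam (v 0) := by
      unfold stepWeight; fun_prop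
    have h1 : Measurable fun v : ℕ → ℝ => contFracApprox β lam k fun i => v (i + 1) :=
      ih.comp (by fun_prop)
    exact h0.div (measurable_const.sub (h0.mul h1))

section Bounds

variable {β lam : ℝ}

lemma stepWeight_le {v : ℝ} (hβ : 0 < β) (hv : v ≤ 1) :
    stepWeight β lam v ≤ 1 / 2 * Real.exp (-(lam - β)) := by
  unfold stepWeight
  gcongr
  nlinarith

lemma stepWeight_le_half {v : ℝ} (hβ : 0 < β) (hlam : β ≤ lam) (hv : v ≤ 1) :
    stepWeight β lam v ≤ 1 / 2 := by
  refine (stepWeight_le hβ hv).trans ?_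
  have : Real.exp (-(lam - β)) ≤ 1 := Real.exp_le_one_iff.2 (by linarith)
  linarith

lemma le_stepWeight {v : ℝ} (hβ : 0 < β) (hv : 0 ≤ v) :
    1 / 2 * Real.exp (-lam) ≤ stepWeight β lam v := by
  unfold stepWeight
  gcongr
  nlinarith

variable {v : ℕ → ℝ}

lemma contFracApprox_mem_Icc (hβ : 0 < β) (hlam : β ≤ lam) (hv : ∀ i, v i ≤ 1) (k : ℕ) :
    contFracApprox β lam k v ∈ Set.Icc (0 : ℝ) 1 := by
  induction k generalizing v with
  | zero => simp [contFracApprox]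
  | succ k ih =>
    obtain ⟨h0, h1⟩ := ih (v := fun i => v (i + 1)) fun i => hv _
    have ha := stepWeight_le_half hβ hlam (hv 0)
    have ha0 := stepWeight_pos β lam (v 0)
    rw [contFracApprox]
    have hd : stepWeight β lam (v 0) * contFracApprox β lam k (fun i => v (i + 1)) ≤ 1 / 2 := by
      nlinarith
    exact ⟨div_nonneg ha0.le (by linarith), (div_le_one (by linarith)).2 (by linarith)⟩

lemma contFracApprox_le_succ (hβ : 0 < β) (hlam : β ≤ lam) (hv : ∀ i, v i ≤ 1) (k : ℕ) :
    contFracApprox β lam k v ≤ contFracApprox β lam (k + 1) v := by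
  induction k generalizing v with
  | zero => exact (contFracApprox_mem_Icc hβ hlam hv 1).1
  | succ k ih =>
    obtain ⟨h0, h1⟩ := contFracApprox_mem_Icc hβ hlam (v := fun i => v (i + 1))
      (fun i => hv _) (k + 1)
    have ha := stepWeight_le_half hβ hlam (hv 0)
    have ha0 := stepWeight_pos β lam (v 0)
    rw [contFracApprox, contFracApprox]
    gcongr
    · nlinarith
    · exact ih fun i => hv _

lemma tendsto_contFracApprox (hβ : 0 < β) (hlam : β ≤ lam) (hv : ∀ i, v i ≤ 1) :
    Tendsto (fun k => contFracApprox β lam k v) atTop (𝓝 (contFrac β lam v)) :=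
  tendsto_atTop_ciSup (monotone_nat_of_le_succ (contFracApprox_le_succ hβ hlam hv))
    ⟨1, by rintro _ ⟨k, rfl⟩; exact (contFracApprox_mem_Icc hβ hlam hv k).2⟩

lemma contFrac_mem_Icc (hβ : 0 < β) (hlam : β ≤ lam) (hv : ∀ i, v i ≤ 1) :
    contFrac β lam v ∈ Set.Icc (0 : ℝ) 1 :=
  isClosed_Icc.mem_of_tendsto (tendsto_contFracApprox hβ hlam hv)
    (Eventually.of_forall (contFracApprox_mem_Icc hβ hlam hv))

/-- The step weight times the continued fraction of the tail is at most `1 / 2`, so that the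
denominators below do not vanish. -/
lemma stepWeight_mul_contFrac_le (hβ : 0 < β) (hlam : β ≤ lam) (hv : ∀ i, v i ≤ 1) :
    stepWeight β lam (v 0) * contFrac β lam (fun i => v (i + 1)) ≤ 1 / 2 := by
  obtain ⟨h0, h1⟩ := contFrac_mem_Icc hβ hlam (v := fun i => v (i + 1)) fun i => hv _
  have ha := stepWeight_le_half hβ hlam (hv 0)
  have ha0 := stepWeight_pos β lam (v 0)
  nlinarith

lemma contFrac_eq (hβ : 0 < β) (hlam : β ≤ lam) (hv : ∀ i, v i ≤ 1) :
    contFrac β lam v = stepWeight β lam (v 0) /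
      (1 - stepWeight β lam (v 0) * contFrac β lam fun i => v (i + 1)) := by
  have h1 := (tendsto_contFracApprox hβ hlam hv).comp (tendsto_add_atTop_nat 1)
  have h2 := tendsto_contFracApprox hβ hlam (v := fun i => v (i + 1)) fun i => hv _
  have h3 := stepWeight_mul_contFrac_le hβ hlam hv
  refine tendsto_nhds_unique h1 ?_
  exact Tendsto.div tendsto_const_nhds
    (tendsto_const_nhds.sub (tendsto_const_nhds.mul h2)) (by linarith)

lemma stepWeight_le_contFrac (hβ : 0 < β) (hlam : β ≤ lam) (hv : ∀ i, v i ≤ 1) :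
    stepWeight β lam (v 0) ≤ contFrac β lam v := by
  have h3 := stepWeight_mul_contFrac_le hβ hlam hv
  obtain ⟨h0, h1⟩ := contFrac_mem_Icc hβ hlam (v := fun i => v (i + 1)) fun i => hv _
  have ha0 := stepWeight_pos β lam (v 0)
  rw [contFrac_eq hβ hlam hv]
  exact le_div_self ha0.le (by linarith) (by nlinarith)

lemma contFrac_pos (hβ : 0 < β) (hlam : β ≤ lam) (hv : ∀ i, v i ≤ 1) : 0 < contFrac β lam v :=
  (stepWeight_pos β lam (v 0)).trans_le (stepWeight_le_contFrac hβ hlam hv)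

lemma contFrac_le_exp (hβ : 0 < β) (hlam : β ≤ lam) (hv : ∀ i, v i ≤ 1) :
    contFrac β lam v ≤ Real.exp (-(lam - β)) := by
  have h3 := stepWeight_mul_contFrac_le hβ hlam hv
  have h4 := stepWeight_le (lam := lam) hβ (hv 0)
  rw [contFrac_eq hβ hlam hv, div_le_iff₀ (by linarith)]
  have := Real.exp_pos (-(lam - β))
  nlinarith

/-- With `x = exp (β (v₀ - 1))`, the bound is `x / (2 - x) ≤ (x + 1) / 2` for `x ≤ 1`. -/
lemma contFrac_le_half_exp_add_one (hβ : 0 < β) (hlam : β ≤ lam) (hv : ∀ i, v i ≤ 1) :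
    contFrac β lam v ≤ 1 / 2 * (Real.exp (β * (v 0 - 1)) + 1) := by
  obtain ⟨h0, h1⟩ := contFrac_mem_Icc hβ hlam (v := fun i => v (i + 1)) fun i => hv _
  have h3 := stepWeight_mul_contFrac_le hβ hlam hv
  have ha0 := stepWeight_pos β lam (v 0)
  have hx : Real.exp (β * (v 0 - 1)) ≤ 1 := Real.exp_le_one_iff.2 (by nlinarith [hv 0])
  have hx0 := Real.exp_pos (β * (v 0 - 1))
  have ha : stepWeight β lam (v 0) ≤ 1 / 2 * Real.exp (β * (v 0 - 1)) := by
    unfold stepWeight; gcongr; linarith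
  rw [contFrac_eq hβ hlam hv, div_le_iff₀ (by linarith)]
  set x := Real.exp (β * (v 0 - 1))
  set a := stepWeight β lam (v 0)
  have h5 : a * contFrac β lam (fun i => v (i + 1)) ≤ 1 / 2 * x := by nlinarith
  nlinarith

/-- Raising `lam` by `h` shrinks the continued fraction at least by the factor `exp (-h)`. -/
lemma contFrac_add_le (hβ : 0 < β) (hlam : β ≤ lam) {h : ℝ} (hh : 0 ≤ h) (hv : ∀ i, v i ≤ 1) :
    contFrac β (lam + h) v ≤ Real.exp (-h) * contFrac β lam v := by
  have he : Real.exp (-h) ≤ 1 := Real.exp_le_one_iff.2 (by linarith)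
  refine le_of_tendsto_of_tendsto (tendsto_contFracApprox hβ (by linarith) hv)
    ((tendsto_contFracApprox hβ hlam hv).const_mul _) (Eventually.of_forall fun k => ?_)
  simp only
  induction k generalizing v with
  | zero => simp [contFracApprox]
  | succ k ih =>
    have hk := ih (v := fun i => v (i + 1)) fun i => hv _
    obtain ⟨h0, h1⟩ := contFracApprox_mem_Icc hβ hlam (v := fun i => v (i + 1)) (fun i => hv _) k
    obtain ⟨h0', h1'⟩ := contFracApprox_mem_Icc hβ (lam := lam + h) (by linarith)
      (v := fun i => v (i + 1)) (fun i => hv _) k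
    have ha := stepWeight_le_half hβ hlam (hv 0)
    have ha0 := stepWeight_pos β lam (v 0)
    rw [contFracApprox, contFracApprox, stepWeight_add, ← mul_div_assoc]
    have hep := Real.exp_pos (-h)
    have hle : contFracApprox β (lam + h) k (fun i => v (i + 1)) ≤
        contFracApprox β lam k (fun i => v (i + 1)) := by nlinarith
    gcongr
    · nlinarith
    · exact mul_le_of_le_one_left ha0.le he

lemma neg_log_contFrac_nonneg (hβ : 0 < β) (hlam : β ≤ lam) (hv : ∀ i, v i ≤ 1) :
    0 ≤ -Real.log (contFrac β lam v) :=
  neg_nonneg.2 (Real.log_nonpos (contFrac_pos hβ hlam hv).le (contFrac_mem_Icc hβ hlam hv).2)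

lemma neg_log_contFrac_le (hβ : 0 < β) (hlam : β ≤ lam) (hv : ∀ i, v i ∈ Set.Icc (0 : ℝ) 1) :
    -Real.log (contFrac β lam v) ≤ lam + Real.log 2 := by
  have h1 := (le_stepWeight (lam := lam) hβ (hv 0).1).trans
    (stepWeight_le_contFrac hβ hlam fun i => (hv i).2)
  have h2 := Real.log_le_log (by positivity) h1
  rw [Real.log_mul (by norm_num) (Real.exp_pos _).ne', Real.log_exp, one_div, Real.log_inv] at h2
  linarith

lemma le_neg_log_contFrac_add (hβ : 0 < β) (hlam : β ≤ lam) {h : ℝ} (hh : 0 ≤ h)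
    (hv : ∀ i, v i ≤ 1) :
    -Real.log (contFrac β lam v) + h ≤ -Real.log (contFrac β (lam + h) v) := by
  have h1 := Real.log_le_log (contFrac_pos hβ (by linarith) hv) (contFrac_add_le hβ hlam hh hv)
  rw [Real.log_mul (Real.exp_pos _).ne' (contFrac_pos hβ hlam hv).ne', Real.log_exp] at h1
  linarith

/-- One step of the recursion for the increment of `-log (contFrac β lam v)` in `lam`: the increment
at the environment is controlled by that at its tail, with the ratio of the jump probabilities,
which is at most `(exp (β (v₀ - 1)) + 1) / 2`, as the factor. -/
lemma neg_log_contFrac_add_sub_le (hβ : 0 < β) (hlam : β ≤ lam) {h : ℝ} (hh : 0 ≤ h)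
    (hv : ∀ i, v i ≤ 1) :
    -Real.log (contFrac β (lam + h) v) - -Real.log (contFrac β lam v) ≤
      h + 1 / 2 * (Real.exp (β * (v 0 - 1)) + 1) *
        (h + (-Real.log (contFrac β (lam + h) fun i => v (i + 1)) -
          -Real.log (contFrac β lam fun i => v (i + 1)))) := by
  have hv' : ∀ i, v (i + 1) ≤ 1 := fun i => hv _
  have hlam' : β ≤ lam + h := by linarith
  set w : ℕ → ℝ := fun i => v (i + 1) with hw
  set a := stepWeight β lam (v 0) with ha
  set u := contFrac β lam w with hu
  set u' := contFrac β (lam + h) w with hu'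
  have ha0 : 0 < a := stepWeight_pos β lam (v 0)
  have hu0 : 0 < u := contFrac_pos hβ hlam hv'
  have hu0' : 0 < u' := contFrac_pos hβ hlam' hv'
  have hu1 : u ≤ 1 := (contFrac_mem_Icc hβ hlam hv').2
  have hd : a * u ≤ 1 / 2 := stepWeight_mul_contFrac_le hβ hlam hv
  have hd' := stepWeight_mul_contFrac_le hβ hlam' hv
  rw [stepWeight_add] at hd'
  change Real.exp (-h) * a * u' ≤ 1 / 2 at hd'
  have hratio : a * u / (1 - a * u) ≤ 1 / 2 * (Real.exp (β * (v 0 - 1)) + 1) := by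
    refine le_trans ?_ (contFrac_le_half_exp_add_one hβ hlam hv)
    rw [contFrac_eq hβ hlam hv]
    gcongr
    · linarith
    · nlinarith
  have hδ : 0 ≤ h + (-Real.log u' - -Real.log u) := by
    have : -Real.log u + h ≤ -Real.log u' := le_neg_log_contFrac_add hβ hlam hh hv'
    linarith
  have heq : -Real.log (contFrac β (lam + h) v) - -Real.log (contFrac β lam v) =
      h + Real.log ((1 - Real.exp (-h) * a * u') / (1 - a * u)) := by
    rw [contFrac_eq hβ hlam hv, contFrac_eq hβ hlam' hv, stepWeight_add]
    change -Real.log (Real.exp (-h) * a / (1 - Real.exp (-h) * a * u')) -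
      -Real.log (a / (1 - a * u)) = _
    rw [Real.log_div (by positivity) (by linarith), Real.log_div ha0.ne' (by linarith),
      Real.log_div (by linarith) (by linarith), Real.log_mul (Real.exp_pos _).ne' ha0.ne',
      Real.log_exp]
    ring
  rw [heq]
  gcongr
  refine le_trans ?_ (mul_le_mul_of_nonneg_right hratio hδ)
  refine (Real.log_le_sub_one_of_pos (div_pos (by linarith) (by linarith))).trans ?_
  have hexp : 1 - (h + (-Real.log u' - -Real.log u)) ≤ Real.exp (-h) * (u' / u) := by
    have := Real.add_one_le_exp (-(h + (-Real.log u' - -Real.log u)))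
    have h2 : Real.exp (-(h + (-Real.log u' - -Real.log u))) = Real.exp (-h) * (u' / u) := by
      rw [show -(h + (-Real.log u' - -Real.log u)) = -h + (Real.log u' - Real.log u) by ring,
        Real.exp_add, Real.exp_sub, Real.exp_log hu0, Real.exp_log hu0']
    linarith
  have h3 : (1 - Real.exp (-h) * a * u') / (1 - a * u) - 1 =
      a * u / (1 - a * u) * (1 - Real.exp (-h) * (u' / u)) := by
    have : 1 - a * u ≠ 0 := by linarith
    field_simp
    ring
  rw [h3]
  have : 0 ≤ a * u / (1 - a * u) := div_nonneg (by positivity) (by linarith)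
  gcongr
  linarith

end Bounds

/-! ### Sums over integer intervals and harmonic functions -/

/-- The additive function on `ℤ` with increments `φ`: the sum of `φ` over `[0, x)` for `x ≥ 0`, and
minus its sum over `[x, 0)` for `x < 0`. -/
def intSum (φ : ℤ → ℝ) (x : ℤ) : ℝ :=
  ∑ j ∈ Finset.range x.toNat, φ j - ∑ j ∈ Finset.range (-x).toNat, φ (-(j + 1 : ℤ))

lemma intSum_zero (φ : ℤ → ℝ) : intSum φ 0 = 0 := by simp [intSum]

lemma intSum_add_one (φ : ℤ → ℝ) (x : ℤ) : intSum φ (x + 1) = intSum φ x + φ x := by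
  unfold intSum
  rcases le_or_gt 0 x with hx | hx
  · lift x to ℕ using hx
    have h1 : ((x : ℤ) + 1).toNat = x + 1 := by omega
    have h2 : (-((x : ℤ) + 1)).toNat = 0 := by omega
    have h3 : (-(x : ℤ)).toNat = 0 := by omega
    rw [h1, h2, h3, Finset.sum_range_succ]
    simp
  · obtain ⟨n, rfl⟩ : ∃ n : ℕ, x = -(n + 1 : ℤ) := ⟨(-x - 1).toNat, by omega⟩
    have h1 : (-(n + 1 : ℤ) + 1).toNat = 0 := by omega
    have h2 : (-(-(n + 1 : ℤ) + 1)).toNat = n := by omega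
    have h3 : (-(n + 1 : ℤ)).toNat = 0 := by omega
    have h4 : (-(-(n + 1 : ℤ))).toNat = n + 1 := by omega
    rw [h1, h2, h3, h4, Finset.sum_range_succ]
    simp

/-- The positive function with `h 0 = 1` and `h (x + 1) = h x / U x`. -/
def expSum (U : ℤ → ℝ) (x : ℤ) : ℝ := Real.exp (intSum (fun y => -Real.log (U y)) x)

section Harmonic

variable {U b : ℤ → ℝ}

lemma expSum_pos (x : ℤ) : 0 < expSum U x := Real.exp_pos _

lemma expSum_zero : expSum U 0 = 1 := by simp [expSum, intSum_zero]

lemma expSum_add_one (hU : ∀ x, 0 < U x) (x : ℤ) : expSum U (x + 1) = expSum U x / U x := by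
  rw [expSum, intSum_add_one, Real.exp_add, Real.exp_neg, Real.exp_log (hU x)]
  rfl

lemma monotone_expSum (hU : ∀ x, 0 < U x) (hU1 : ∀ x, U x ≤ 1) : Monotone (expSum U) := by
  refine monotone_int_of_le_succ fun x => ?_
  rw [expSum_add_one hU]
  exact le_div_self (expSum_pos x).le (hU x) (hU1 x)

/-- If `U` solves the continued fraction recursion, then `expSum U` is invariant under the weighted
random walk. -/
lemma transfer_expSum (hU : ∀ x, 0 < U x) (hrec : ∀ x, U x * (1 - b x / 2 * U (x - 1)) = b x / 2) :
    transfer b (expSum U) = expSum U := by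
  funext x
  have h1 := expSum_add_one hU (x - 1)
  rw [sub_add_cancel] at h1
  have h2 : expSum U (x - 1) = expSum U x * U (x - 1) := by
    rw [h1, div_mul_cancel₀ _ (hU _).ne']
  rw [transfer, expSum_add_one hU x, h2]
  have := (hU x).ne'
  field_simp
  linear_combination (-2 * expSum U x) * hrec x

lemma transfer_iterate_eq_self {h : ℤ → ℝ} (hh : transfer b h = h) (n : ℕ) :
    (transfer b)^[n] h = h := Function.iterate_fixed hh n

/-- The walk makes at most `n` steps in time `n`, so a comparison of `f` and `g` on `[-n, n]` is
enough. -/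
lemma transfer_iterate_mono (hb : ∀ x, 0 ≤ b x) {f g : ℤ → ℝ} (n : ℕ)
    (hfg : ∀ x : ℤ, |x| ≤ n → f x ≤ g x) :
    (transfer b)^[n] f 0 ≤ (transfer b)^[n] g 0 := by
  rw [← integral_prod_walk_mul, ← integral_prod_walk_mul]
  refine integral_mono (integrable_prod_walk_mul b f n) (integrable_prod_walk_mul b g n) fun s => ?_
  exact mul_le_mul_of_nonneg_left (hfg _ (abs_walk_le s n)) (Finset.prod_nonneg fun i _ => hb _)

lemma transfer_iterate_const_mul (c : ℝ) (f : ℤ → ℝ) (n : ℕ) :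
    (transfer b)^[n] (fun x => c * f x) 0 = c * (transfer b)^[n] f 0 := by
  rw [← integral_prod_walk_mul, ← integral_prod_walk_mul, ← integral_const_mul]
  congr 1
  funext s
  ring

/-! ### The walk stopped at its first visit to `1` -/

/-- The weighted value of `h` along the walk stopped at the first visit to `1`. -/
def stoppedValue (b h : ℤ → ℝ) : ℕ → (ℕ → Bool) → ℝ
  | 0, _ => h 0
  | n + 1, s => open Classical in if ∃ i ≤ n, walk s i = 1 then stoppedValue b h n s else
      (∏ i ∈ Finset.range (n + 1), b (walk s i)) * h (walk s (n + 1))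

variable {h : ℤ → ℝ} {s : ℕ → Bool}

lemma stoppedValue_of_forall_ne {n : ℕ} (hs : ∀ i ≤ n, walk s i ≠ 1) :
    stoppedValue b h n s = (∏ i ∈ Finset.range n, b (walk s i)) * h (walk s n) := by
  rcases n with _ | n
  · simp [stoppedValue, walk_zero]
  · rw [stoppedValue, if_neg]
    rintro ⟨i, hi, h1⟩
    exact hs i (by omega) h1

lemma stoppedValue_of_first_hit {t n : ℕ} (ht : walk s t = 1) (hs : ∀ i < t, walk s i ≠ 1)
    (hn : t ≤ n) :
    stoppedValue b h n s = (∏ i ∈ Finset.range t, b (walk s i)) * h 1 := by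
  induction n, hn using Nat.le_induction with
  | base =>
    rcases t with _ | t
    · simp [walk_zero] at ht
    · rw [stoppedValue, if_neg, ht]
      rintro ⟨i, hi, h1⟩
      exact hs i (by omega) h1
  | succ n hn ih => rw [stoppedValue, if_pos ⟨t, hn, ht⟩, ih]

lemma measurable_stoppedValue (b h : ℤ → ℝ) (n : ℕ) : Measurable (stoppedValue b h n) := by
  induction n with
  | zero => exact measurable_const
  | succ n ih =>
    refine Measurable.ite ?_ ih ((measurable_prod_walk b _).mul
      ((measurable_of_countable h).comp (measurable_walk _)))
    have : {s : ℕ → Bool | ∃ i ≤ n, walk s i = 1} =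
        ⋃ i ∈ Finset.range (n + 1), (fun s => walk s i) ⁻¹' {1} := by
      ext s; simp
    rw [this]
    exact Finset.measurableSet_biUnion _ fun i _ => measurable_walk i (measurableSet_singleton 1)

lemma prod_walk_flipAt {m n : ℕ} (hm : m ≤ n + 1) (s : ℕ → Bool) :
    ∏ i ∈ Finset.range m, b (walk (flipAt n s) i) = ∏ i ∈ Finset.range m, b (walk s i) :=
  Finset.prod_congr rfl fun i hi => by
    rw [walk_flipAt (by have := Finset.mem_range.1 hi; omega)]

lemma stoppedValue_flipAt {m n : ℕ} (hm : m ≤ n) (s : ℕ → Bool) :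
    stoppedValue b h m (flipAt n s) = stoppedValue b h m s := by
  induction m with
  | zero => rfl
  | succ m ih =>
    rw [stoppedValue, stoppedValue, ih (by omega), walk_flipAt hm, prod_walk_flipAt (by omega)]
    congr 1
    simp only [eq_iff_iff]
    refine exists_congr fun i => and_congr_right fun hi => ?_
    rw [walk_flipAt (by omega)]

/-- The stopped weighted walk is a martingale if `h` is invariant under `transfer b`. -/
lemma stoppedValue_average (hh : transfer b h = h) (n : ℕ) (s : ℕ → Bool) :
    (stoppedValue b h (n + 1) s + stoppedValue b h (n + 1) (flipAt n s)) / 2 =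
      stoppedValue b h n s := by
  by_cases hs : ∃ i ≤ n, walk s i = 1
  · have hs' : ∃ i ≤ n, walk (flipAt n s) i = 1 := by
      obtain ⟨i, hi, h1⟩ := hs
      exact ⟨i, hi, by rw [walk_flipAt hi, h1]⟩
    rw [stoppedValue, stoppedValue, if_pos hs, if_pos hs', stoppedValue_flipAt le_rfl]
    ring
  · have hs' : ¬ ∃ i ≤ n, walk (flipAt n s) i = 1 := by
      rintro ⟨i, hi, h1⟩
      exact hs ⟨i, hi, by rw [← h1, walk_flipAt hi]⟩
    rw [stoppedValue, stoppedValue, if_neg hs, if_neg hs', prod_walk_flipAt le_rfl, ← mul_add,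
      add_apply_flipAt, stoppedValue_of_forall_ne fun i hi h1 => hs ⟨i, hi, h1⟩,
      Finset.prod_range_succ]
    have := congrFun hh (walk s n)
    rw [transfer] at this
    linear_combination (∏ i ∈ Finset.range n, b (walk s i)) * this

lemma walk_nonpos_of_forall_ne {n : ℕ} (hs : ∀ i ≤ n, walk s i ≠ 1) : walk s n ≤ 0 := by
  induction n with
  | zero => simp [walk_zero]
  | succ n ih =>
    have h1 := ih fun i hi => hs i (by omega)
    have h2 := hs (n + 1) le_rfl
    rw [walk_succ] at h2 ⊢
    have : step (s n) ≤ 1 := by unfold step; split_ifs <;> simp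
    omega

lemma prod_walk_mem (hb : ∀ x, 0 ≤ b x) {c : ℝ} (hbc : ∀ x, b x ≤ c) (n : ℕ) (s : ℕ → Bool) :
    0 ≤ ∏ i ∈ Finset.range n, b (walk s i) ∧ ∏ i ∈ Finset.range n, b (walk s i) ≤ c ^ n := by
  refine ⟨Finset.prod_nonneg fun i _ => hb _, ?_⟩
  simpa using Finset.prod_le_prod (s := Finset.range n) (fun i _ => hb (walk s i))
    (fun i _ => hbc (walk s i))

lemma exists_first_hit (hs : ∃ t, walk s t = 1) :
    ∃ t, walk s t = 1 ∧ (∀ i < t, walk s i ≠ 1) ∧ hitTime 1 s = t := by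
  classical
  refine ⟨Nat.find hs, Nat.find_spec hs, fun i hi => Nat.find_min hs hi, ?_⟩
  refine le_antisymm
    (iInf₂_le (f := fun (i : ℕ) (_ : walk s i = 1) => (i : ℕ∞)) _ (Nat.find_spec hs))
    (le_iInf₂ fun i hi => ?_)
  exact_mod_cast Nat.find_min' hs hi

lemma hitTime_eq_top (hs : ¬ ∃ t, walk s t = 1) : hitTime 1 s = ⊤ := by
  simp only [not_exists] at hs
  simp [hitTime, hs]

/-- Optional stopping for weights bounded by `c < 1`: the total weight of the paths up to their
first visit to `1`, times `h 1`, is `h 0`. Paths that avoid `1` do not contribute in the limit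
because their weight decays geometrically. -/
lemma integral_prod_hitTime (hb : ∀ x, 0 ≤ b x) {c : ℝ} (hc : c < 1) (hbc : ∀ x, b x ≤ c)
    (hh : transfer b h = h) (h0 : ∀ x, 0 ≤ h x) (hmono : Monotone h) :
    (∫ s, (if hitTime 1 s = ⊤ then 0 else
      ∏ i ∈ Finset.range (hitTime 1 s).toNat, b (walk s i)) ∂coinLaw) * h 1 = h 0 := by
  have hc0 : 0 ≤ c := (hb 0).trans (hbc 0)
  have hbound : ∀ n s, 0 ≤ stoppedValue b h n s ∧ stoppedValue b h n s ≤ h 1 := by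
    intro n s
    by_cases hs : ∀ i ≤ n, walk s i ≠ 1
    · rw [stoppedValue_of_forall_ne hs]
      obtain ⟨p0, p1⟩ := prod_walk_mem hb hbc n s
      have := hmono ((walk_nonpos_of_forall_ne hs).trans zero_le_one)
      refine ⟨mul_nonneg p0 (h0 _), ?_⟩
      have : c ^ n ≤ 1 := pow_le_one₀ hc0 hc.le
      nlinarith [h0 (walk s n), h0 1]
    · push Not at hs
      obtain ⟨i, hi, h1⟩ := hs
      obtain ⟨t, ht, hlt, -⟩ := exists_first_hit ⟨i, h1⟩
      have hti : t ≤ i := by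
        by_contra hlt'
        exact hlt i (by omega) h1
      rw [stoppedValue_of_first_hit ht hlt (hti.trans hi)]
      obtain ⟨p0, p1⟩ := prod_walk_mem hb hbc t s
      have : c ^ t ≤ 1 := pow_le_one₀ hc0 hc.le
      exact ⟨mul_nonneg p0 (h0 _), mul_le_of_le_one_left (h0 1) (p1.trans this)⟩
  have hint : ∀ n, Integrable (stoppedValue b h n) coinLaw := fun n =>
    Integrable.of_bound (measurable_stoppedValue b h n).aestronglyMeasurable (h 1)
      (Eventually.of_forall fun s => by
        rw [Real.norm_eq_abs, abs_of_nonneg (hbound n s).1]; exact (hbound n s).2)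
  have hconst : ∀ n, ∫ s, stoppedValue b h n s ∂coinLaw = h 0 := by
    intro n
    induction n with
    | zero => simp [stoppedValue]
    | succ n ih =>
      rw [integral_eq_average_flipAt n (hint _), ← ih]
      exact integral_congr_ae (Eventually.of_forall fun s => stoppedValue_average hh n s)
  have hlim : Tendsto (fun n => ∫ s, stoppedValue b h n s ∂coinLaw) atTop
      (𝓝 (∫ s, (if hitTime 1 s = ⊤ then 0 else
        ∏ i ∈ Finset.range (hitTime 1 s).toNat, b (walk s i)) * h 1 ∂coinLaw)) := by
    refine tendsto_integral_of_dominated_convergence (fun _ => h 1) (fun n =>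
      (hint n).aestronglyMeasurable) (integrable_const _)
      (fun n => Eventually.of_forall fun s => ?_) (Eventually.of_forall fun s => ?_)
    · rw [Real.norm_eq_abs, abs_of_nonneg (hbound n s).1]; exact (hbound n s).2
    · by_cases hs : ∃ t, walk s t = 1
      · obtain ⟨t, ht, hlt, htop⟩ := exists_first_hit hs
        rw [htop, if_neg (ENat.natCast_ne_top t), ENat.toNat_natCast]
        refine tendsto_const_nhds.congr' ?_
        filter_upwards [eventually_ge_atTop t] with n hn
        exact (stoppedValue_of_first_hit ht hlt hn).symm
      · rw [hitTime_eq_top hs, if_pos rfl, zero_mul]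
        have hz : Tendsto (fun n => c ^ n * h 1) atTop (𝓝 0) := by
          simpa using (tendsto_pow_atTop_nhds_zero_of_lt_one hc0 hc).mul_const (h 1)
        refine squeeze_zero (fun n => (hbound n s).1) (fun n => ?_) hz
        simp only [not_exists] at hs
        rw [stoppedValue_of_forall_ne fun i _ => hs i]
        have := hmono ((walk_nonpos_of_forall_ne fun i (_ : i ≤ n) => hs i).trans zero_le_one)
        obtain ⟨p0, p1⟩ := prod_walk_mem hb hbc n s
        exact mul_le_mul p1 this (h0 _) (pow_nonneg hc0 n)
  simp only [hconst] at hlim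
  rw [integral_mul_const] at hlim
  exact (tendsto_nhds_unique hlim tendsto_const_nhds)

end Harmonic

/-! ### Growth of the path weights -/

lemma transfer_nonneg {b h : ℤ → ℝ} (hb : ∀ x, 0 ≤ b x) (hh : ∀ x, 0 ≤ h x) (x : ℤ) :
    0 ≤ transfer b h x :=
  mul_nonneg (hb x) (div_nonneg (add_nonneg (hh _) (hh _)) zero_le_two)

/-- If `h` is nonnegative, does not decrease under `transfer b`, and is positive somewhere, then the
iterates at the origin are bounded below by a positive constant from some time on. -/
lemma exists_pos_le_transfer_iterate {b h : ℤ → ℝ} (hb : ∀ x, 0 < b x) (hh : ∀ x, 0 ≤ h x)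
    (hsub : ∀ x, h x ≤ transfer b h x) {y : ℤ} (hy : 0 < h y) :
    ∃ δ > 0, ∃ N, ∀ n ≥ N, δ ≤ (transfer b)^[n] h 0 := by
  have hnonneg : ∀ n x, 0 ≤ (transfer b)^[n] h x := by
    intro n
    induction n with
    | zero => exact hh
    | succ n ih =>
      rw [Function.iterate_succ_apply']
      exact transfer_nonneg (fun x => (hb x).le) ih
  have hmono : ∀ n x, (transfer b)^[n] h x ≤ (transfer b)^[n + 1] h x := by
    intro n
    induction n with
    | zero => exact hsub
    | succ n ih =>
      intro x
      rw [Function.iterate_succ_apply', Function.iterate_succ_apply' _ (n + 1), transfer, transfer]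
      have := hb x
      gcongr
      · exact ih _
      · exact ih _
  have hpos : ∀ m : ℕ, 0 < (transfer b)^[m] h (y - m) ∧ 0 < (transfer b)^[m] h (y + m) := by
    intro m
    induction m with
    | zero => simpa using hy
    | succ m ih =>
      rw [Function.iterate_succ_apply']
      constructor
      · have h1 := hnonneg m (y - (m + 1 : ℕ) - 1)
        have h2 : y - (m + 1 : ℕ) + 1 = y - m := by push_cast; ring
        refine mul_pos (hb _) (div_pos ?_ two_pos)
        rw [h2]
        exact add_pos_of_pos_of_nonneg ih.1 h1
      · have h1 := hnonneg m (y + (m + 1 : ℕ) + 1)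
        have h2 : y + (m + 1 : ℕ) - 1 = y + m := by push_cast; ring
        refine mul_pos (hb _) (div_pos ?_ two_pos)
        rw [h2]
        exact add_pos_of_nonneg_of_pos h1 ih.2
  -- The walk can be at the distance `|y|` from `y` after `|y|` steps.
  have h0 : 0 < (transfer b)^[y.natAbs] h 0 := by
    rcases Int.natAbs_eq y with h | h
    · have := (hpos y.natAbs).1
      rwa [show y - (y.natAbs : ℤ) = 0 by omega] at this
    · have := (hpos y.natAbs).2
      rwa [show y + (y.natAbs : ℤ) = 0 by omega] at this
  refine ⟨_, h0, y.natAbs, fun n hn => ?_⟩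
  have : Monotone fun n => (transfer b)^[n] h 0 := monotone_nat_of_le_succ fun n => hmono n 0
  exact this hn

/-- A parabola over a stretch of `2 L - 1` sites on which the weight is at least `κ > 1` does not
decrease under `transfer b`, once `L` is large. -/
lemma le_transfer_parabola {b : ℤ → ℝ} (hb : ∀ x, 0 ≤ b x) {κ : ℝ} {L : ℕ}
    (hL : κ ≤ (2 * L - 1) * (κ - 1)) (hκ : 1 < κ) {y : ℤ}
    (hy : ∀ x : ℤ, |x - y| < L → κ ≤ b x) (x : ℤ) :
    max 0 ((L : ℝ) ^ 2 - ((x : ℝ) - y) ^ 2) ≤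
      transfer b (fun z : ℤ => max 0 ((L : ℝ) ^ 2 - ((z : ℝ) - y) ^ 2)) x := by
  refine max_le (transfer_nonneg hb (fun z => le_max_left _ _) x) ?_
  by_cases hx : |x - y| < L
  · have h1 := hy x hx
    have h2 : |(x : ℝ) - y| ≤ L - 1 := by
      have : |x - y| + 1 ≤ (L : ℤ) := hx
      have : ((|x - y| + 1 : ℤ) : ℝ) ≤ ((L : ℤ) : ℝ) := by exact_mod_cast this
      push_cast at this
      linarith
    have h3 : ((x : ℝ) - y) ^ 2 ≤ ((L : ℝ) - 1) ^ 2 := by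
      rw [← sq_abs]
      gcongr
    set p := (L : ℝ) ^ 2 - ((x : ℝ) - y) ^ 2 with hp
    have h4 : 2 * (L : ℝ) - 1 ≤ p := by nlinarith
    have h5 : p - 1 ≤ (max 0 ((L : ℝ) ^ 2 - (((x + 1 : ℤ) : ℝ) - y) ^ 2) +
        max 0 ((L : ℝ) ^ 2 - (((x - 1 : ℤ) : ℝ) - y) ^ 2)) / 2 := by
      have e1 := le_max_right 0 ((L : ℝ) ^ 2 - (((x + 1 : ℤ) : ℝ) - y) ^ 2)
      have e2 := le_max_right 0 ((L : ℝ) ^ 2 - (((x - 1 : ℤ) : ℝ) - y) ^ 2)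
      have e3 : p - 1 = ((L : ℝ) ^ 2 - (((x + 1 : ℤ) : ℝ) - y) ^ 2 +
        ((L : ℝ) ^ 2 - (((x - 1 : ℤ) : ℝ) - y) ^ 2)) / 2 := by push_cast; rw [hp]; ring
      linarith
    have h6 : 1 < 2 * (L : ℝ) - 1 := by nlinarith
    have h7 : p ≤ κ * (p - 1) := by nlinarith
    calc p ≤ κ * (p - 1) := h7
      _ ≤ b x * (p - 1) := by gcongr; linarith
      _ ≤ _ := mul_le_mul_of_nonneg_left h5 (hb x)
  · have h2 : (L : ℝ) ≤ |(x : ℝ) - y| := by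
      have : (L : ℤ) ≤ |x - y| := not_lt.1 hx
      have : ((L : ℤ) : ℝ) ≤ ((|x - y| : ℤ) : ℝ) := by exact_mod_cast this
      push_cast at this
      linarith
    have h3 : (L : ℝ) ^ 2 ≤ ((x : ℝ) - y) ^ 2 := by
      rw [← sq_abs ((x : ℝ) - y)]
      gcongr
    exact (sub_nonpos.2 h3).trans (transfer_nonneg hb (fun z => le_max_left _ _) x)

/-! ### The environment seen along the orbit -/

section Environment

variable {Ω : Type*} [MeasurableSpace Ω]

section Shift

variable (T : Ω ≃ᵐ Ω)

lemma shift_zero (ω : Ω) : shift T 0 ω = ω := by simp [shift]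

lemma shift_add (i j : ℤ) (ω : Ω) : shift T (i + j) ω = shift T i (shift T j ω) := by
  simp [shift, zpow_add]

lemma shift_natCast (n : ℕ) (ω : Ω) : shift T n ω = T^[n] ω := by
  simp only [shift, zpow_natCast]
  rw [← Equiv.Perm.iterate_eq_pow]
  rfl

lemma shift_neg_natCast (n : ℕ) (ω : Ω) : shift T (-n) ω = T.symm^[n] ω := by
  simp only [shift, zpow_neg, zpow_natCast]
  rw [← inv_pow, ← Equiv.Perm.iterate_eq_pow]
  rfl

lemma shift_symm (j : ℤ) (ω : Ω) : shift T.symm j ω = shift T (-j) ω := by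
  rcases Int.eq_nat_or_neg j with ⟨n, rfl | rfl⟩
  · rw [shift_natCast, shift_neg_natCast]
  · rw [shift_neg_natCast, neg_neg, shift_natCast]
    rfl

lemma measurable_shift (j : ℤ) : Measurable (shift T j) := by
  rcases Int.eq_nat_or_neg j with ⟨n, rfl | rfl⟩
  · rw [show shift T (n : ℤ) = T^[n] from funext (shift_natCast T n)]
    exact T.measurable.iterate n
  · rw [show shift T (-(n : ℤ)) = T.symm^[n] from funext (shift_neg_natCast T n)]
    exact T.symm.measurable.iterate n

lemma measurePreserving_shift {P : Measure Ω} {T : Ω ≃ᵐ Ω} (hT : MeasurePreserving T P P) (j : ℤ) :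
    MeasurePreserving (shift T j) P P := by
  rcases Int.eq_nat_or_neg j with ⟨n, rfl | rfl⟩
  · rw [show shift T (n : ℤ) = T^[n] from funext (shift_natCast T n)]
    exact hT.iterate n
  · rw [show shift T (-(n : ℤ)) = T.symm^[n] from funext (shift_neg_natCast T n)]
    exact (hT.symm T).iterate n

lemma integral_comp_shift {P : Measure Ω} {T : Ω ≃ᵐ Ω} (hT : MeasurePreserving T P P) (j : ℤ)
    {f : Ω → ℝ} (hf : Measurable f) : ∫ ω, f (shift T j ω) ∂P = ∫ ω, f ω ∂P := by
  have h := measurePreserving_shift hT j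
  have := integral_map (μ := P) (φ := shift T j) (f := f) h.measurable.aemeasurable
    hf.aestronglyMeasurable
  rw [h.map_eq] at this
  exact this.symm

/-- The ergodic theorem along both directions of the orbit. -/
lemma ae_abs_intSum_sub_le {P : Measure Ω} [IsProbabilityMeasure P] {T : Ω ≃ᵐ Ω} (hT : Ergodic T P)
    {f : Ω → ℝ} (hf : Measurable f) {C : ℝ} (hC : ∀ ω, |f ω| ≤ C) :
    ∀ᵐ ω ∂P, ∀ ε > 0, ∃ B, ∀ x : ℤ,
      |intSum (fun y => f (shift T y ω)) x - x * ∫ ω, f ω ∂P| ≤ |(x : ℝ)| * ε + B := by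
  have hf' : Measurable fun ω => f (T.symm ω) := hf.comp T.symm.measurable
  have hmean : ∫ ω, f (T.symm ω) ∂P = ∫ ω, f ω ∂P := by
    have := integral_comp_shift hT.toMeasurePreserving (-1) hf
    exact this
  filter_upwards [ae_abs_birkhoffSum_sub_le hT hf hC,
    ae_abs_birkhoffSum_sub_le (f := fun ω => f (T.symm ω)) hT.symm hf' fun ω => hC _]
    with ω h1 h2 ε hε
  obtain ⟨B, hB⟩ := h1 ε hε
  obtain ⟨D, hD⟩ := h2 ε hε
  refine ⟨max B D, fun x => ?_⟩
  rcases Int.eq_nat_or_neg x with ⟨n, rfl | rfl⟩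
  · have h3 : intSum (fun y => f (shift T y ω)) n = birkhoffSum T f n ω := by
      simp [intSum, birkhoffSum, shift_natCast]
    rw [h3]
    have := hB n
    simp only [Int.cast_natCast, Nat.abs_cast]
    exact this.trans (by gcongr; exact le_max_left _ _)
  · have h3 : intSum (fun y => f (shift T y ω)) (-n) =
        -birkhoffSum T.symm (fun ω => f (T.symm ω)) n ω := by
      have h0 : (-(n : ℤ)).toNat = 0 := by omega
      rw [intSum, h0, neg_neg, Int.toNat_natCast, birkhoffSum]
      simp only [Finset.range_zero, Finset.sum_empty, zero_sub, neg_inj]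
      refine Finset.sum_congr rfl fun j _ => ?_
      rw [← Nat.cast_add_one, shift_neg_natCast, Function.iterate_succ_apply']
    rw [h3]
    have := hD n
    rw [hmean] at this
    push_cast
    rw [abs_neg, Nat.abs_cast, ← abs_neg]
    refine (le_of_eq ?_).trans (this.trans (by gcongr; exact le_max_right _ _))
    congr 1
    ring

end Shift

/-- The continued fraction of the environment to the left of the origin. For `lam > β` it is
`passageFn`; unlike that function it is easily studied for `lam = β` as well. -/
def leftFrac (T : Ω ≃ᵐ Ω) (V : Ω → ℝ) (β lam : ℝ) (ω : Ω) : ℝ :=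
  contFrac β lam fun i : ℕ => V (shift T (-(i : ℤ)) ω)

/-- The exponential growth rate in space of the harmonic functions with the factor `exp (-lam)` per
step. It is a right inverse of the tilted free energy. -/
def growthRate (P : Measure Ω) (T : Ω ≃ᵐ Ω) (V : Ω → ℝ) (β lam : ℝ) : ℝ :=
  ∫ ω, -Real.log (leftFrac T V β lam ω) ∂P

/-- The weight `exp (β V - lam)` of a step from the site `x`. -/
def siteWeight (T : Ω ≃ᵐ Ω) (V : Ω → ℝ) (β lam : ℝ) (ω : Ω) (x : ℤ) : ℝ :=
  Real.exp (β * V (shift T x ω) - lam)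

variable {T : Ω ≃ᵐ Ω} {V : Ω → ℝ} {β lam : ℝ}

lemma siteWeight_pos (ω : Ω) (x : ℤ) : 0 < siteWeight T V β lam ω x := Real.exp_pos _

lemma measurable_leftFrac (hV : Measurable V) : Measurable (leftFrac T V β lam) :=
  (measurable_contFrac β lam).comp (measurable_pi_lambda _ fun _ => hV.comp (measurable_shift T _))

lemma leftFrac_tail (ω : Ω) :
    leftFrac T V β lam (shift T (-1) ω) =
      contFrac β lam fun i : ℕ => V (shift T (-((i + 1 : ℕ) : ℤ)) ω) := by
  unfold leftFrac
  congr 1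
  funext i
  rw [← shift_add]
  congr 2
  push_cast
  ring

lemma leftFrac_eq (hβ : 0 < β) (hlam : β ≤ lam) (hV01 : ∀ ω, V ω ∈ Set.Icc (0 : ℝ) 1) (ω : Ω) :
    leftFrac T V β lam ω * (1 - stepWeight β lam (V ω) * leftFrac T V β lam (shift T (-1) ω)) =
      stepWeight β lam (V ω) := by
  have h1 := contFrac_eq hβ hlam (v := fun i : ℕ => V (shift T (-(i : ℤ)) ω)) fun i => (hV01 _).2
  have h2 := stepWeight_mul_contFrac_le hβ hlam (v := fun i : ℕ => V (shift T (-(i : ℤ)) ω))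
    fun i => (hV01 _).2
  rw [leftFrac_tail]
  simp only [Nat.cast_zero, neg_zero, shift_zero] at h1 h2
  rw [leftFrac, h1, div_mul_cancel₀]
  linarith

lemma leftFrac_pos (hβ : 0 < β) (hlam : β ≤ lam) (hV01 : ∀ ω, V ω ∈ Set.Icc (0 : ℝ) 1) (ω : Ω) :
    0 < leftFrac T V β lam ω := contFrac_pos hβ hlam fun _ => (hV01 _).2

lemma leftFrac_le_one (hβ : 0 < β) (hlam : β ≤ lam) (hV01 : ∀ ω, V ω ∈ Set.Icc (0 : ℝ) 1) (ω : Ω) :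
    leftFrac T V β lam ω ≤ 1 := (contFrac_mem_Icc hβ hlam fun _ => (hV01 _).2).2

lemma leftFrac_le_exp (hβ : 0 < β) (hlam : β ≤ lam) (hV01 : ∀ ω, V ω ∈ Set.Icc (0 : ℝ) 1) (ω : Ω) :
    leftFrac T V β lam ω ≤ Real.exp (-(lam - β)) := contFrac_le_exp hβ hlam fun _ => (hV01 _).2

lemma leftFrac_le_rBar (hβ : 0 < β) (hlam : β ≤ lam) (hV01 : ∀ ω, V ω ∈ Set.Icc (0 : ℝ) 1)
    (ω : Ω) : leftFrac T V β lam ω ≤ rBar V β ω := by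
  have := contFrac_le_half_exp_add_one hβ hlam (v := fun i : ℕ => V (shift T (-(i : ℤ)) ω))
    fun i => (hV01 _).2
  simp only [Nat.cast_zero, neg_zero, shift_zero] at this
  exact this

lemma abs_log_leftFrac_le (hβ : 0 < β) (hlam : β ≤ lam) (hV01 : ∀ ω, V ω ∈ Set.Icc (0 : ℝ) 1)
    (ω : Ω) : |-Real.log (leftFrac T V β lam ω)| ≤ lam + Real.log 2 := by
  rw [leftFrac, abs_of_nonneg (neg_log_contFrac_nonneg hβ hlam fun _ => (hV01 _).2)]
  exact neg_log_contFrac_le hβ hlam fun _ => hV01 _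

lemma integrable_log_leftFrac {P : Measure Ω} [IsProbabilityMeasure P] (hV : Measurable V)
    (hβ : 0 < β) (hlam : β ≤ lam) (hV01 : ∀ ω, V ω ∈ Set.Icc (0 : ℝ) 1) :
    Integrable (fun ω => -Real.log (leftFrac T V β lam ω)) P :=
  Integrable.of_bound (measurable_leftFrac hV).log.neg.aestronglyMeasurable _
    (Eventually.of_forall (abs_log_leftFrac_le hβ hlam hV01))

/-- The harmonic function built from `leftFrac` along the orbit of `ω`. -/
lemma transfer_expSum_leftFrac (hβ : 0 < β) (hlam : β ≤ lam)
    (hV01 : ∀ ω, V ω ∈ Set.Icc (0 : ℝ) 1) (ω : Ω) :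
    transfer (siteWeight T V β lam ω) (expSum fun x => leftFrac T V β lam (shift T x ω)) =
      expSum fun x => leftFrac T V β lam (shift T x ω) := by
  refine transfer_expSum (fun x => leftFrac_pos hβ hlam hV01 _) fun x => ?_
  have h := leftFrac_eq (T := T) hβ hlam hV01 (shift T x ω)
  rw [← shift_add] at h
  have h2 : siteWeight T V β lam ω x / 2 = stepWeight β lam (V (shift T x ω)) := by
    unfold siteWeight stepWeight; ring
  rw [h2, show x - 1 = -1 + x by ring]
  exact h

lemma prod_siteWeight (ω : Ω) (s : ℕ → Bool) (n : ℕ) :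
    ∏ i ∈ Finset.range n, siteWeight T V β lam ω (walk s i) =
      Real.exp (β * pathSum T V ω s n - lam * n) := by
  unfold siteWeight pathSum
  rw [← Real.exp_sum, Finset.sum_sub_distrib, Finset.mul_sum]
  simp [mul_comm]

lemma passageFn_eq_leftFrac (hβ : 0 < β) (hlam : β < lam) (hV01 : ∀ ω, V ω ∈ Set.Icc (0 : ℝ) 1)
    (ω : Ω) : passageFn T V β lam ω = leftFrac T V β lam ω := by
  have hpos := leftFrac_pos (T := T) hβ hlam.le hV01
  have h := integral_prod_hitTime (b := siteWeight T V β lam ω)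
    (h := expSum fun x => leftFrac T V β lam (shift T x ω)) (c := Real.exp (-(lam - β)))
    (fun x => (siteWeight_pos ω x).le) (by rw [Real.exp_lt_one_iff]; linarith)
    (fun x => Real.exp_le_exp.2 (by nlinarith [(hV01 (shift T x ω)).2]))
    (transfer_expSum_leftFrac hβ hlam.le hV01 ω) (fun x => (expSum_pos x).le)
    (monotone_expSum (fun x => hpos _) fun x => leftFrac_le_one hβ hlam.le hV01 _)
  have h1 := expSum_add_one (U := fun x => leftFrac T V β lam (shift T x ω)) (fun x => hpos _) 0
  rw [zero_add, expSum_zero, shift_zero] at h1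
  rw [h1, expSum_zero] at h
  simp only [prod_siteWeight] at h
  rw [mul_one_div, div_eq_one_iff_eq (hpos ω).ne'] at h
  exact h

/-! ### The partition function -/

lemma partitionFn_eq_transfer (lam θ : ℝ) (n : ℕ) (ω : Ω) :
    partitionFn T V β θ n ω =
      Real.exp (lam * n) *
        (transfer (siteWeight T V β lam ω))^[n] (fun x => Real.exp (θ * x)) 0 := by
  rw [← integral_prod_walk_mul, ← integral_const_mul, partitionFn]
  congr 1
  funext s
  rw [prod_siteWeight, ← Real.exp_add, ← Real.exp_add]
  congr 1
  ring

lemma partitionFn_pos (θ : ℝ) (n : ℕ) (ω : Ω) : 0 < partitionFn T V β θ n ω := by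
  have h : ∀ x, 0 < (transfer (siteWeight T V β 0 ω))^[n] (fun x => Real.exp (θ * x)) x := by
    induction n with
    | zero => exact fun x => Real.exp_pos _
    | succ n ih =>
      intro x
      rw [Function.iterate_succ_apply']
      exact mul_pos (siteWeight_pos ω x) (div_pos (add_pos (ih _) (ih _)) two_pos)
  rw [partitionFn_eq_transfer 0]
  exact mul_pos (Real.exp_pos _) (h 0)

lemma transfer_reflect (b f : ℤ → ℝ) (n : ℕ) (x : ℤ) :
    (transfer fun y => b (-y))^[n] (fun y => f (-y)) x = (transfer b)^[n] f (-x) := by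
  induction n generalizing x with
  | zero => rfl
  | succ n ih =>
    rw [Function.iterate_succ_apply', Function.iterate_succ_apply', transfer, transfer, ih, ih,
      show -(x + 1) = -x - 1 by ring, show -(x - 1) = -x + 1 by ring, add_comm (_ : ℝ)]

/-- Reflecting the line reverses the environment and the tilt. -/
lemma partitionFn_symm (θ : ℝ) (n : ℕ) (ω : Ω) :
    partitionFn T.symm V β θ n ω = partitionFn T V β (-θ) n ω := by
  rw [partitionFn_eq_transfer 0, partitionFn_eq_transfer 0]
  have h := transfer_reflect (siteWeight T V β 0 ω) (fun x => Real.exp (-θ * x)) n 0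
  rw [neg_zero] at h
  rw [← h]
  have h1 : siteWeight T.symm V β 0 ω = fun y => siteWeight T V β 0 ω (-y) := by
    funext x; simp [siteWeight, shift_symm]
  have h2 : (fun x : ℤ => Real.exp (θ * x)) = fun y : ℤ => Real.exp (-θ * ((-y : ℤ) : ℝ)) := by
    funext x; simp
  rw [h1, h2]

lemma partitionFn_le_add {θ t : ℝ} (hθ : |θ| ≤ t) (n : ℕ) (ω : Ω) :
    partitionFn T V β θ n ω ≤ partitionFn T V β t n ω + partitionFn T V β (-t) n ω := by
  rw [partitionFn_eq_transfer 0, partitionFn_eq_transfer 0, partitionFn_eq_transfer 0, ← mul_add]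
  gcongr
  simp only [← integral_prod_walk_mul]
  have hint : ∀ t : ℝ, Integrable (fun s => (∏ i ∈ Finset.range n,
      siteWeight T V β 0 ω (walk s i)) * Real.exp (t * (walk s n : ℝ))) coinLaw := fun t =>
    integrable_prod_walk_mul (siteWeight T V β 0 ω) (fun x => Real.exp (t * x)) n
  rw [← integral_add (hint t) (hint (-t))]
  refine integral_mono (hint θ) ((hint t).add (hint (-t))) fun s => ?_
  simp only
  rw [← mul_add]
  refine mul_le_mul_of_nonneg_left ?_ (Finset.prod_nonneg fun i _ => (siteWeight_pos ω _).le)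
  have h1 : θ * (walk s n : ℝ) ≤ t * |(walk s n : ℝ)| :=
    (le_abs_self _).trans (by rw [abs_mul]; gcongr)
  rcases abs_cases (walk s n : ℝ) with ⟨h, -⟩ | ⟨h, -⟩
  · rw [h] at h1
    linarith [Real.exp_le_exp.2 h1, Real.exp_pos (-t * (walk s n : ℝ))]
  · rw [h, mul_neg, ← neg_mul] at h1
    linarith [Real.exp_le_exp.2 h1, Real.exp_pos (t * (walk s n : ℝ))]

lemma tendsto_one_div_mul {x : ℕ → ℝ} {l : ℝ}
    (hu : ∀ ε > 0, ∃ B, ∀ᶠ n : ℕ in atTop, x n ≤ n * (l + ε) + B)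
    (hl : ∀ ε > 0, ∃ B, ∀ᶠ n : ℕ in atTop, n * (l - ε) - B ≤ x n) :
    Tendsto (fun n : ℕ => (1 / (n : ℝ)) * x n) atTop (𝓝 l) := by
  rw [tendsto_order]
  constructor
  · intro a ha
    obtain ⟨B, hB⟩ := hl ((l - a) / 2) (by linarith)
    filter_upwards [hB, eventually_gt_atTop 0,
      (tendsto_natCast_atTop_atTop (R := ℝ)).eventually_gt_atTop (B / ((l - a) / 2))]
      with n h1 h2 h3
    have hn : (0 : ℝ) < n := by exact_mod_cast h2
    rw [div_lt_iff₀ (by linarith)] at h3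
    rw [one_div_mul_eq_div, lt_div_iff₀ hn]
    nlinarith
  · intro a ha
    obtain ⟨B, hB⟩ := hu ((a - l) / 2) (by linarith)
    filter_upwards [hB, eventually_gt_atTop 0,
      (tendsto_natCast_atTop_atTop (R := ℝ)).eventually_gt_atTop (B / ((a - l) / 2))]
      with n h1 h2 h3
    have hn : (0 : ℝ) < n := by exact_mod_cast h2
    rw [div_lt_iff₀ (by linarith)] at h3
    rw [one_div_mul_eq_div, div_lt_iff₀ hn]
    nlinarith

lemma eventually_le_of_tendsto_one_div_mul {x : ℕ → ℝ} {l : ℝ}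
    (h : Tendsto (fun n : ℕ => (1 / (n : ℝ)) * x n) atTop (𝓝 l)) {ε : ℝ} (hε : 0 < ε) :
    ∀ᶠ n : ℕ in atTop, x n ≤ n * (l + ε) := by
  filter_upwards [h.eventually_lt_const (show l < l + ε by linarith), eventually_gt_atTop 0]
    with n h1 h2
  have hn : (0 : ℝ) < n := by exact_mod_cast h2
  rw [one_div_mul_eq_div, div_lt_iff₀ hn] at h1
  linarith

variable {P : Measure Ω} [IsProbabilityMeasure P]

lemma freeEnergy_eq {θ l : ℝ} (h : IsTiltedFreeEnergy P T V β θ l) :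
    freeEnergy P T V β θ = l := by
  have hex : ∃ l, IsTiltedFreeEnergy P T V β θ l := ⟨l, h⟩
  rw [freeEnergy, dif_pos hex]
  obtain ⟨ω, h1, h2⟩ := (hex.choose_spec.and h).exists
  exact tendsto_nhds_unique h1 h2

/-- At the tilt `growthRate lam`, the tilting function agrees up to a subexponential factor with the
harmonic function for `lam`, so that the free energy is `lam`. -/
lemma isTiltedFreeEnergy_growthRate (hT : Ergodic T P) (hV : Measurable V) (hβ : 0 < β)
    (hlam : β ≤ lam) (hV01 : ∀ ω, V ω ∈ Set.Icc (0 : ℝ) 1) :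
    IsTiltedFreeEnergy P T V β (growthRate P T V β lam) lam := by
  have hpos := leftFrac_pos (T := T) hβ hlam hV01
  filter_upwards [ae_abs_intSum_sub_le hT (measurable_leftFrac hV).log.neg
    (abs_log_leftFrac_le (T := T) hβ hlam hV01)] with ω hω
  set g := growthRate P T V β lam with hg
  set b := siteWeight T V β lam ω with hb
  set h := expSum fun x => leftFrac T V β lam (shift T x ω) with hh
  have hharm : ∀ n, (transfer b)^[n] h 0 = 1 := fun n => by
    rw [transfer_iterate_eq_self (transfer_expSum_leftFrac hβ hlam hV01 ω), expSum_zero]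
  have hbound : ∀ ε > 0, ∃ B, ∀ (n : ℕ) (x : ℤ), |x| ≤ n →
      |intSum (fun y => -Real.log (leftFrac T V β lam (shift T y ω))) x - g * x| ≤ n * ε + B := by
    intro ε hε
    obtain ⟨B, hB⟩ := hω ε hε
    refine ⟨B, fun n x hx => ?_⟩
    have hx' : |(x : ℝ)| ≤ n := by exact_mod_cast hx
    rw [mul_comm g]
    exact (hB x).trans (by gcongr)
  have hb0 : ∀ x, 0 ≤ b x := fun x => (siteWeight_pos ω x).le
  refine tendsto_one_div_mul (fun ε hε => ?_) (fun ε hε => ?_)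
  · obtain ⟨B, hB⟩ := hbound ε hε
    refine ⟨B, Eventually.of_forall fun n => ?_⟩
    rw [Real.log_le_iff_le_exp (partitionFn_pos _ _ _), partitionFn_eq_transfer lam,
      show n * (lam + ε) + B = lam * n + (n * ε + B) by ring, Real.exp_add]
    refine mul_le_mul_of_nonneg_left ?_ (Real.exp_pos _).le
    rw [← mul_one (Real.exp (n * ε + B)), ← hharm n, ← transfer_iterate_const_mul]
    refine transfer_iterate_mono hb0 n fun x hx => ?_
    rw [hh, expSum, ← Real.exp_add]
    exact Real.exp_le_exp.2 (by linarith [(abs_le.1 (hB n x hx)).1])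
  · obtain ⟨B, hB⟩ := hbound ε hε
    refine ⟨B, Eventually.of_forall fun n => ?_⟩
    rw [Real.le_log_iff_exp_le (partitionFn_pos _ _ _), partitionFn_eq_transfer lam,
      show n * (lam - ε) - B = lam * n + -(n * ε + B) by ring, Real.exp_add]
    refine mul_le_mul_of_nonneg_left ?_ (Real.exp_pos _).le
    rw [← mul_one (Real.exp (-(n * ε + B))), ← hharm n, ← transfer_iterate_const_mul]
    refine transfer_iterate_mono hb0 n fun x hx => ?_
    rw [hh, expSum, ← Real.exp_add]
    exact Real.exp_le_exp.2 (by linarith [(abs_le.1 (hB n x hx)).2])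

/-- Arbitrarily long stretches on which the potential is almost `1` force the free energy to be at
least `β`: the walk can reach such a stretch and stay there at a negligible cost. -/
lemma linear_lower_bound_of_stretch (hβ : 0 < β) {ω : Ω}
    (hω : ∀ η > 0, ∀ L : ℕ, ∃ y : ℤ, ∀ x : ℤ, |x - y| < L → 1 - η ≤ V (shift T x ω))
    (θ : ℝ) {ε : ℝ} (hε : 0 < ε) :
    ∃ B, ∀ᶠ n : ℕ in atTop, n * (β - ε) - B ≤ Real.log (partitionFn T V β θ n ω) := by
  have hκ : 1 < Real.exp (ε / 2) := Real.one_lt_exp_iff.2 (by linarith)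
  set κ := Real.exp (ε / 2) with hκdef
  -- The parabola is at least `2 L - 1` on the stretch; this must compensate for its curvature.
  obtain ⟨L, hL⟩ := exists_nat_ge (κ / (κ - 1) + 1)
  have hL0 : (0 : ℝ) < L := by
    have : 0 < κ / (κ - 1) := div_pos (by linarith) (by linarith)
    linarith
  have hL' : κ ≤ (2 * L - 1) * (κ - 1) := by
    have h1 : κ / (κ - 1) ≤ 2 * L - 1 := by linarith
    rwa [div_le_iff₀ (by linarith)] at h1
  obtain ⟨y, hy⟩ := hω (ε / (2 * β)) (by positivity) L
  set b := siteWeight T V β (β - ε) ω with hb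
  have hbκ : ∀ x : ℤ, |x - y| < L → κ ≤ b x := fun x hx => by
    rw [hκdef, hb, siteWeight, Real.exp_le_exp]
    have h1 := mul_le_mul_of_nonneg_left (hy x hx) hβ.le
    have h2 : β * (1 - ε / (2 * β)) = β - ε / 2 := by field_simp
    linarith
  set h : ℤ → ℝ := fun z => max 0 ((L : ℝ) ^ 2 - ((z : ℝ) - y) ^ 2) with hh
  obtain ⟨δ, hδ, N, hN⟩ := exists_pos_le_transfer_iterate (b := b) (h := h)
    (siteWeight_pos ω) (fun x => le_max_left _ _)
    (le_transfer_parabola (fun x => (siteWeight_pos ω x).le) hL' hκ hbκ) (y := y)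
    (by rw [hh]; exact lt_max_of_lt_right (by
      rw [sub_self, zero_pow two_ne_zero, sub_zero]; positivity))
  set C := (L : ℝ) ^ 2 * Real.exp (|θ| * (|(y : ℝ)| + L)) with hC
  have hC0 : 0 < C := by positivity
  -- The parabola is bounded and vanishes outside a bounded set.
  have hhC : ∀ x : ℤ, h x ≤ C * Real.exp (θ * x) := fun x => by
    refine max_le (by positivity) ?_
    by_cases hx : |(x : ℝ) - y| < L
    · have h1 : |(x : ℝ)| ≤ |(y : ℝ)| + L := by
        have := abs_add_le (y : ℝ) ((x : ℝ) - y)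
        rw [add_sub_cancel] at this
        linarith
      have h2 : 1 ≤ Real.exp (|θ| * (|(y : ℝ)| + L)) * Real.exp (θ * x) := by
        rw [← Real.exp_add, Real.one_le_exp_iff]
        have h3 := neg_abs_le (θ * (x : ℝ))
        rw [abs_mul] at h3
        have h4 := mul_le_mul_of_nonneg_left h1 (abs_nonneg θ)
        linarith
      rw [hC, mul_assoc]
      have h5 : (L : ℝ) ^ 2 - ((x : ℝ) - y) ^ 2 ≤ (L : ℝ) ^ 2 := by
        linarith [sq_nonneg ((x : ℝ) - y)]
      exact h5.trans (le_mul_of_one_le_right (by positivity) h2)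
    · have h3 : (L : ℝ) ^ 2 ≤ ((x : ℝ) - y) ^ 2 := by
        rw [← sq_abs ((x : ℝ) - y)]
        gcongr
        exact not_lt.1 hx
      exact (sub_nonpos.2 h3).trans (by positivity)
  refine ⟨-Real.log (δ / C), ?_⟩
  filter_upwards [eventually_ge_atTop N] with n hn
  rw [Real.le_log_iff_exp_le (partitionFn_pos _ _ _), partitionFn_eq_transfer (β - ε),
    show n * (β - ε) - -Real.log (δ / C) = (β - ε) * n + Real.log (δ / C) by ring, Real.exp_add,
    Real.exp_log (by positivity)]
  refine mul_le_mul_of_nonneg_left ?_ (Real.exp_pos _).le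
  rw [div_le_iff₀' hC0, ← transfer_iterate_const_mul]
  exact (hN n hn).trans
    (transfer_iterate_mono (fun x => (siteWeight_pos ω x).le) n fun x _ => hhC x)

end Environment

/-! ### Independent environments -/

section Independent

variable {Ω : Type*} {V : Ω → ℝ} {β lam : ℝ}

lemma rBar_nonneg (ω : Ω) : 0 ≤ rBar V β ω := by unfold rBar; positivity

lemma rBar_le_one (hβ : 0 < β) (hV01 : ∀ ω, V ω ∈ Set.Icc (0 : ℝ) 1) (ω : Ω) :
    rBar V β ω ≤ 1 := by
  have : Real.exp (β * (V ω - 1)) ≤ 1 := Real.exp_le_one_iff.2 (by nlinarith [(hV01 ω).2])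
  unfold rBar
  linarith

variable [MeasurableSpace Ω] {P : Measure Ω} {T : Ω ≃ᵐ Ω}

lemma measurable_rBar (hV : Measurable V) : Measurable (rBar V β) := by
  unfold rBar; fun_prop

lemma integrable_rBar [IsProbabilityMeasure P] (hV : Measurable V) (hβ : 0 < β)
    (hV01 : ∀ ω, V ω ∈ Set.Icc (0 : ℝ) 1) :
    Integrable (rBar V β) P :=
  Integrable.of_bound (measurable_rBar hV).aestronglyMeasurable 1 (Eventually.of_forall fun ω => by
    rw [Real.norm_eq_abs, abs_of_nonneg (rBar_nonneg ω)]
    exact rBar_le_one hβ hV01 ω)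

lemma integral_rBar_lt_one [IsProbabilityMeasure P] (hV : Measurable V) (hβ : 0 < β)
    (hV01 : ∀ ω, V ω ∈ Set.Icc (0 : ℝ) 1)
    (hInf : essInf V P = 0) : ∫ ω, rBar V β ω ∂P < 1 := by
  by_contra hge
  have hint := integrable_rBar (P := P) hV hβ hV01
  have hzero : ∫ ω, (1 - rBar V β ω) ∂P = 0 := by
    refine le_antisymm ?_ (integral_nonneg fun ω => sub_nonneg.2 (rBar_le_one hβ hV01 ω))
    rw [integral_sub (integrable_const _) hint]
    simp only [integral_const, probReal_univ, smul_eq_mul, mul_one]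
    linarith
  rw [integral_eq_zero_iff_of_nonneg (fun ω => sub_nonneg.2 (rBar_le_one hβ hV01 ω))
    ((integrable_const _).sub hint)] at hzero
  have hV1 : V =ᵐ[P] fun _ => 1 := by
    filter_upwards [hzero] with ω hω
    simp only [Pi.zero_apply, rBar] at hω
    have h1 : Real.exp (β * (V ω - 1)) = 1 := by linarith
    rw [Real.exp_eq_one_iff] at h1
    rcases mul_eq_zero.1 h1 with h | h <;> linarith
  rw [essInf_congr_ae hV1, essInf_const'] at hInf
  exact one_ne_zero hInf

lemma integrable_prod_rBar [IsProbabilityMeasure P] (hV : Measurable V) (hβ : 0 < β)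
    (hV01 : ∀ ω, V ω ∈ Set.Icc (0 : ℝ) 1) (c : ℕ → ℤ) (n : ℕ) :
    Integrable (fun ω => ∏ i ∈ Finset.range n, rBar V β (shift T (c i) ω)) P := by
  refine Integrable.of_bound (C := 1) (Measurable.aestronglyMeasurable ?_)
    (Eventually.of_forall fun ω => ?_)
  · exact Finset.measurable_prod _ fun i _ => (measurable_rBar hV).comp (measurable_shift T _)
  · rw [Real.norm_eq_abs, abs_of_nonneg (Finset.prod_nonneg fun i _ => rBar_nonneg _)]
    exact Finset.prod_le_one (fun i _ => rBar_nonneg _) fun i _ => rBar_le_one hβ hV01 _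

lemma sum_pow_add_pow_succ_le {ρ : ℝ} (h0 : 0 ≤ ρ) (h1 : ρ < 1) (n : ℕ) :
    ∑ k ∈ Finset.range n, (ρ ^ k + ρ ^ (k + 1)) ≤ (1 + ρ) / (1 - ρ) := by
  have h2 : ∑ k ∈ Finset.range n, (ρ ^ k + ρ ^ (k + 1)) =
      (1 + ρ) * ∑ k ∈ Finset.range n, ρ ^ k := by
    rw [Finset.mul_sum]
    exact Finset.sum_congr rfl fun k _ => by ring
  have h3 := geom_sum_mul_neg ρ n
  have h4 := pow_nonneg h0 n
  rw [h2, le_div_iff₀ (by linarith), mul_assoc, h3]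
  nlinarith

section Law

variable (hV : Measurable V)
  (hIndep : iIndepFun (fun (j : ℤ) (ω : Ω) => V (shift T j ω)) P)
  (hIdent : ∀ j : ℤ, IdentDistrib (fun ω => V (shift T j ω)) V P P)

include hV hIndep hIdent

/-- The potential along any sequence of distinct sites has the same law. -/
lemma map_potential_eq {c : ℕ → ℤ} (hc : Function.Injective c) :
    P.map (fun ω (i : ℕ) => V (shift T (c i) ω)) = Measure.infinitePi fun _ => P.map V := by
  have h := (hIndep.precomp hc).map_fun_eq_infinitePi_map
    (fun i => hV.comp (measurable_shift T (c i)))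
  refine h.trans ?_
  congr 1
  funext i
  exact (hIdent (c i)).map_eq

/-- Reversing an independent, identically distributed environment does not change the growth
rate. -/
lemma growthRate_symm : growthRate P T.symm V β lam = growthRate P T V β lam := by
  have hF : Measurable fun v : ℕ → ℝ => -Real.log (contFrac β lam v) :=
    (measurable_contFrac β lam).log.neg
  have hm : ∀ c : ℕ → ℤ, Measurable fun ω (i : ℕ) => V (shift T (c i) ω) := fun c =>
    measurable_pi_lambda _ fun i => hV.comp (measurable_shift T _)
  have h1 : growthRate P T V β lam =
      ∫ v, -Real.log (contFrac β lam v) ∂(P.map fun ω (i : ℕ) => V (shift T (-(i : ℤ)) ω)) := by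
    rw [integral_map (hm _).aemeasurable hF.aestronglyMeasurable]
    rfl
  have h2 : growthRate P T.symm V β lam =
      ∫ v, -Real.log (contFrac β lam v) ∂(P.map fun ω (i : ℕ) => V (shift T (i : ℤ) ω)) := by
    rw [integral_map (hm _).aemeasurable hF.aestronglyMeasurable]
    simp only [growthRate, leftFrac, shift_symm, neg_neg]
  rw [h1, h2, map_potential_eq hV hIndep hIdent fun i j h => by simpa using h,
    map_potential_eq hV hIndep hIdent fun i j h => by simpa using h]

lemma integral_prod_rBar {c : ℕ → ℤ} (hc : Function.Injective c) (n : ℕ) :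
    ∫ ω, ∏ i ∈ Finset.range n, rBar V β (shift T (c i) ω) ∂P = (∫ ω, rBar V β ω ∂P) ^ n := by
  have hind := hIndep.precomp (g := fun i : Fin n => c i) (hc.comp Fin.val_injective)
  have hR : Measurable fun x : ℝ => 1 / 2 * (Real.exp (β * (x - 1)) + 1) := by fun_prop
  have h := hind.integral_fun_prod_comp (𝕜 := ℝ)
    (f := fun _ x => 1 / 2 * (Real.exp (β * (x - 1)) + 1))
    (fun i => (hV.comp (measurable_shift T _)).aemeasurable) (fun _ => hR.aestronglyMeasurable)
  have hone : ∀ j : ℤ, ∫ ω, 1 / 2 * (Real.exp (β * (V (shift T j ω) - 1)) + 1) ∂P =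
      ∫ ω, rBar V β ω ∂P := fun j => ((hIdent j).comp hR).integral_eq
  simp only [hone, Finset.prod_const, Finset.card_univ, Fintype.card_fin] at h
  rw [← h]
  congr 1
  funext ω
  rw [Finset.prod_range]
  rfl

variable [IsProbabilityMeasure P]

/-- Independence makes long stretches of almost maximal potential possible, and ergodicity makes
them appear along almost every orbit. -/
lemma ae_exists_stretch (hT : Ergodic T P) (hV01 : ∀ ω, V ω ∈ Set.Icc (0 : ℝ) 1)
    (hSup : essSup V P = 1) :
    ∀ᵐ ω ∂P, ∀ η > 0, ∀ L : ℕ, ∃ y : ℤ, ∀ x : ℤ, |x - y| < L → 1 - η ≤ V (shift T x ω) := by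
  have hpos : ∀ η > 0, P (V ⁻¹' Set.Ici (1 - η)) ≠ 0 := by
    intro η hη h0
    have h1 : V ≤ᵐ[P] fun _ => 1 - η := by
      filter_upwards [measure_eq_zero_iff_ae_notMem.1 h0] with ω hω
      simp only [Set.mem_preimage, Set.mem_Ici, not_le] at hω
      exact hω.le
    have h2 := essSup_le_of_ae_le _ h1 (IsCoboundedUnder.of_frequently_ge (a := 0)
      (Eventually.of_forall fun ω => (hV01 ω).1).frequently)
    linarith
  have hmain : ∀ k L : ℕ, ∀ᵐ ω ∂P, ∃ y : ℤ, ∀ x : ℤ, |x - y| < L →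
      1 - 1 / ((k : ℝ) + 1) ≤ V (shift T x ω) := by
    intro k L
    set η : ℝ := 1 / ((k : ℝ) + 1) with hη
    have hη0 : 0 < η := by positivity
    set E : Set Ω := ⋂ x ∈ Finset.Ioo (-(L : ℤ)) L, (fun ω => V (shift T x ω)) ⁻¹' Set.Ici (1 - η)
      with hE
    have hEm : MeasurableSet E := Finset.measurableSet_biInter _ fun x _ =>
      (hV.comp (measurable_shift T x)) measurableSet_Ici
    have hEpos : P E ≠ 0 := by
      rw [hE, hIndep.meas_biInter fun x _ => ⟨_, measurableSet_Ici, rfl⟩, Finset.prod_ne_zero_iff]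
      intro x _
      rw [(hIdent x).measure_mem_eq measurableSet_Ici]
      exact hpos η hη0
    have hmean : 0 < ∫ ω, E.indicator (1 : Ω → ℝ) ω ∂P := by
      rw [integral_indicator_one hEm]
      exact ENNReal.toReal_pos hEpos (measure_ne_top P E)
    set p := ∫ ω, E.indicator (1 : Ω → ℝ) ω ∂P
    filter_upwards [ae_abs_birkhoffSum_sub_le hT (measurable_one.indicator hEm) (C := 1)
      (fun ω => by by_cases h : ω ∈ E <;> simp [h])] with ω hω
    obtain ⟨B, hB⟩ := hω (p / 2) (by linarith)
    by_contra! hno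
    -- An orbit that never meets `E` has Birkhoff averages `0`, not `P E`.
    have hnever : ∀ n : ℕ, T^[n] ω ∉ E := by
      intro n hn
      obtain ⟨x, hx, hlt⟩ := hno n
      simp only [hE, Set.mem_iInter, Finset.mem_Ioo] at hn
      have := hn (x - n) (abs_lt.1 hx)
      simp only [Set.mem_preimage, Set.mem_Ici] at this
      rw [← shift_natCast, ← shift_add, sub_add_cancel] at this
      linarith
    have hsum : ∀ n, birkhoffSum T (E.indicator (1 : Ω → ℝ)) n ω = 0 := fun n =>
      Finset.sum_eq_zero fun j _ => Set.indicator_of_notMem (hnever j) _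
    obtain ⟨n, hn⟩ := exists_nat_gt (B / (p / 2))
    have h1 := hB n
    rw [hsum, zero_sub, abs_neg, abs_of_nonneg (by positivity)] at h1
    rw [div_lt_iff₀ (by linarith)] at hn
    linarith
  filter_upwards [ae_all_iff.2 fun k => ae_all_iff.2 (hmain k)] with ω hω η hη L
  obtain ⟨k, hk⟩ := exists_nat_one_div_lt hη
  obtain ⟨y, hy⟩ := hω k L
  exact ⟨y, fun x hx => by linarith [hy x hx]⟩

/-- Both the series bounding `E[(1 + r) S]` and the one bounding the increments of the growth rate
are of this form. -/
lemma integral_sum_prod_rBar_le (hInf : essInf V P = 0) (hβ : 0 < β)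
    (hV01 : ∀ ω, V ω ∈ Set.Icc (0 : ℝ) 1) {c d : ℕ → ℤ} (hc : Function.Injective c)
    (hd : Function.Injective d) (n : ℕ) :
    ∫ ω, ∑ k ∈ Finset.range n, (∏ j ∈ Finset.range k, rBar V β (shift T (c j) ω) +
        ∏ j ∈ Finset.range (k + 1), rBar V β (shift T (d j) ω)) ∂P ≤
      (1 + ∫ ω, rBar V β ω ∂P) / (1 - ∫ ω, rBar V β ω ∂P) := by
  have hip := fun c : ℕ → ℤ => integrable_prod_rBar (P := P) (T := T) hV hβ hV01 c
  have h1 : ∀ k, ∫ ω, (∏ j ∈ Finset.range k, rBar V β (shift T (c j) ω) +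
      ∏ j ∈ Finset.range (k + 1), rBar V β (shift T (d j) ω)) ∂P =
      (∫ ω, rBar V β ω ∂P) ^ k + (∫ ω, rBar V β ω ∂P) ^ (k + 1) := fun k => by
    rw [integral_add (hip c k) (hip d (k + 1)), integral_prod_rBar hV hIndep hIdent hc,
      integral_prod_rBar hV hIndep hIdent hd]
  rw [integral_finsetSum]
  · simp only [h1]
    exact sum_pow_add_pow_succ_le (integral_nonneg rBar_nonneg)
      (integral_rBar_lt_one hV hβ hV01 hInf) n
  · exact fun k _ => (hip c k).add (hip d (k + 1))

end Law

/-! ### The growth rate is bi-Lipschitz -/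

variable [IsProbabilityMeasure P]

lemma le_of_affine_recursion {δ R : ℕ → ℝ} {h : ℝ} (hR : ∀ k, 0 ≤ R k)
    (hδ : ∀ k, δ k ≤ h + R k * (h + δ (k + 1))) (n : ℕ) :
    δ 0 ≤ h * ∑ k ∈ Finset.range n, (∏ j ∈ Finset.range k, R j + ∏ j ∈ Finset.range (k + 1), R j) +
      (∏ j ∈ Finset.range n, R j) * δ n := by
  induction n with
  | zero => simp
  | succ n ih =>
    have h1 := mul_le_mul_of_nonneg_left (hδ n)
      (Finset.prod_nonneg fun j (_ : j ∈ Finset.range n) => hR j)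
    rw [Finset.sum_range_succ, Finset.prod_range_succ]
    linarith

lemma growthRate_add_le (hV : Measurable V) (hβ : 0 < β) (hlam : β ≤ lam)
    (hV01 : ∀ ω, V ω ∈ Set.Icc (0 : ℝ) 1) {h : ℝ} (hh : 0 ≤ h) :
    growthRate P T V β lam + h ≤ growthRate P T V β (lam + h) := by
  have h1 := integrable_log_leftFrac (P := P) (T := T) hV hβ hlam hV01
  have h2 := integrable_log_leftFrac (P := P) (T := T) hV hβ (show β ≤ lam + h by linarith) hV01
  have h3 : growthRate P T V β lam + h = ∫ ω, (-Real.log (leftFrac T V β lam ω) + h) ∂P := by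
    rw [integral_add h1 (integrable_const _)]
    simp [growthRate]
  rw [h3]
  exact integral_mono (h1.add (integrable_const _)) h2 fun ω =>
    le_neg_log_contFrac_add hβ hlam hh fun _ => (hV01 _).2

/-- The increments of the growth rate are bounded by the same geometric series as the expectation of
`(1 + r) S`: the recursion for the increments is iterated along the orbit, and independence makes
the expectations of the products of the factors decay geometrically. -/
lemma growthRate_add_sub_le (hV : Measurable V)
    (hIndep : iIndepFun (fun (j : ℤ) (ω : Ω) => V (shift T j ω)) P)
    (hIdent : ∀ j : ℤ, IdentDistrib (fun ω => V (shift T j ω)) V P P)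
    (hInf : essInf V P = 0) (hβ : 0 < β) (hlam : β ≤ lam)
    (hV01 : ∀ ω, V ω ∈ Set.Icc (0 : ℝ) 1) {h : ℝ} (hh : 0 ≤ h) :
    growthRate P T V β (lam + h) - growthRate P T V β lam ≤
      h * ((1 + ∫ ω, rBar V β ω ∂P) / (1 - ∫ ω, rBar V β ω ∂P)) := by
  set ρ := ∫ ω, rBar V β ω ∂P with hρ
  have hρ1 : ρ < 1 := integral_rBar_lt_one hV hβ hV01 hInf
  have hρ0 : 0 ≤ ρ := integral_nonneg rBar_nonneg
  have hlam' : β ≤ lam + h := by linarith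
  set δ : Ω → ℝ := fun ω =>
    -Real.log (leftFrac T V β (lam + h) ω) - -Real.log (leftFrac T V β lam ω) with hδ
  have h1 := integrable_log_leftFrac (P := P) (T := T) hV hβ hlam hV01
  have h2 := integrable_log_leftFrac (P := P) (T := T) hV hβ hlam' hV01
  set c : ℕ → ℤ := fun i => -(i : ℤ) with hc
  have hcinj : Function.Injective c := fun i j h => by simpa [hc] using h
  have hrec : ∀ ω, δ ω ≤ h + rBar V β ω * (h + δ (shift T (-1) ω)) := by
    intro ω
    have := neg_log_contFrac_add_sub_le hβ hlam hh
      (v := fun i : ℕ => V (shift T (-(i : ℤ)) ω)) fun i => (hV01 _).2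
    rw [← leftFrac_tail, ← leftFrac_tail] at this
    simp only [Nat.cast_zero, neg_zero, shift_zero] at this
    exact this
  have hiter : ∀ n ω, δ ω ≤ h * ∑ k ∈ Finset.range n,
      (∏ j ∈ Finset.range k, rBar V β (shift T (c j) ω) +
        ∏ j ∈ Finset.range (k + 1), rBar V β (shift T (c j) ω)) +
      (∏ j ∈ Finset.range n, rBar V β (shift T (c j) ω)) * (lam + h + Real.log 2) := by
    intro n ω
    have h3 := le_of_affine_recursion (δ := fun k => δ (shift T (c k) ω))
      (R := fun k => rBar V β (shift T (c k) ω)) (h := h) (fun k => rBar_nonneg _)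
      (fun k => by
        have := hrec (shift T (c k) ω)
        rw [← shift_add, show -1 + c k = c (k + 1) by simp only [hc]; push_cast; ring] at this
        exact this) n
    have h4 : δ (shift T (c n) ω) ≤ lam + h + Real.log 2 := by
      have e1 := (le_abs_self _).trans
        (abs_log_leftFrac_le (T := T) hβ hlam' hV01 (shift T (c n) ω))
      have e2 := neg_log_contFrac_nonneg hβ hlam
        (v := fun i : ℕ => V (shift T (-(i : ℤ)) (shift T (c n) ω))) fun i => (hV01 _).2
      simp only [hδ]
      change 0 ≤ -Real.log (leftFrac T V β lam (shift T (c n) ω)) at e2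
      linarith
    have h5 : δ (shift T (c 0) ω) = δ ω := by simp [hc, shift_zero]
    rw [h5] at h3
    refine h3.trans ?_
    gcongr
    exact Finset.prod_nonneg fun j _ => rBar_nonneg _
  have hip := integrable_prod_rBar (P := P) (T := T) hV hβ hV01 c
  have hn : ∀ n : ℕ, growthRate P T V β (lam + h) - growthRate P T V β lam ≤
      h * ((1 + ρ) / (1 - ρ)) + ρ ^ n * (lam + h + Real.log 2) := by
    intro n
    have hsum : Integrable (fun ω => ∑ k ∈ Finset.range n,
      (∏ j ∈ Finset.range k, rBar V β (shift T (c j) ω) +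
        ∏ j ∈ Finset.range (k + 1), rBar V β (shift T (c j) ω))) P :=
      integrable_finsetSum _ fun k _ => (hip k).add (hip (k + 1))
    have h3 : growthRate P T V β (lam + h) - growthRate P T V β lam = ∫ ω, δ ω ∂P :=
      (integral_sub h2 h1).symm
    rw [h3]
    refine (integral_mono (h2.sub h1) ((hsum.const_mul h).add ((hip n).mul_const _))
      (hiter n)).trans ?_
    rw [integral_add' (hsum.const_mul h) ((hip n).mul_const _), integral_const_mul,
      integral_mul_const, integral_prod_rBar hV hIndep hIdent hcinj]
    gcongr
    exact integral_sum_prod_rBar_le hV hIndep hIdent hInf hβ hV01 hcinj hcinj n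
  have hlim : Tendsto (fun n : ℕ => h * ((1 + ρ) / (1 - ρ)) + ρ ^ n * (lam + h + Real.log 2)) atTop
      (𝓝 (h * ((1 + ρ) / (1 - ρ)))) := by
    simpa using ((tendsto_pow_atTop_nhds_zero_of_lt_one hρ0 hρ1).mul_const
      (lam + h + Real.log 2)).const_add (h * ((1 + ρ) / (1 - ρ)))
  exact ge_of_tendsto' hlim hn

/-- The growth rate at `lam = β` is positive, by `-log u ≥ 1 - u ≥ 1 - rBar`. -/
lemma growthRate_pos (hV : Measurable V) (hInf : essInf V P = 0) (hβ : 0 < β)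
    (hV01 : ∀ ω, V ω ∈ Set.Icc (0 : ℝ) 1) : 0 < growthRate P T V β β := by
  have h1 := integral_rBar_lt_one hV hβ hV01 hInf
  have hint := integrable_rBar (P := P) hV hβ hV01
  have h2 : ∫ ω, (1 - rBar V β ω) ∂P ≤ growthRate P T V β β := by
    refine integral_mono ((integrable_const _).sub hint)
      (integrable_log_leftFrac hV hβ le_rfl hV01) fun ω => ?_
    have h3 := Real.log_le_sub_one_of_pos (leftFrac_pos (T := T) hβ le_rfl hV01 ω)
    have h4 := leftFrac_le_rBar (T := T) hβ le_rfl hV01 ω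
    simp only
    linarith
  rw [integral_sub (integrable_const _) hint] at h2
  simp only [integral_const, probReal_univ, smul_eq_mul, mul_one] at h2
  linarith

end Independent

/-! ### The drift of the tilted walk -/

section Ratio

variable {Ω : Type*} [MeasurableSpace Ω] {P : Measure Ω} {T : Ω ≃ᵐ Ω} {V : Ω → ℝ} {β θ : ℝ}

lemma ratio_eq (hβ : 0 < β) (hV01 : ∀ ω, V ω ∈ Set.Icc (0 : ℝ) 1)
    (hθ : β < freeEnergy P T V β θ) (ω : Ω) :
    ratio P T V β θ ω = leftFrac T V β (freeEnergy P T V β θ) ω *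
      leftFrac T V β (freeEnergy P T V β θ) (shift T (-1) ω) := by
  set lam := freeEnergy P T V β θ with hlam
  have hu := leftFrac_pos (T := T) hβ hθ.le hV01 ω
  have hrec := leftFrac_eq (T := T) hβ hθ.le hV01 ω
  have hw := stepWeight_pos β lam (V ω)
  have hq : jumpRight P T V β θ ω = stepWeight β lam (V ω) / leftFrac T V β lam ω := by
    rw [jumpRight, corrector, ← hlam, passageFn_eq_leftFrac hβ hθ hV01, stepWeight,
      show β * V ω + θ + (-Real.log (leftFrac T V β lam ω) - θ) - lam =
        (β * V ω - lam) - Real.log (leftFrac T V β lam ω) by ring, Real.exp_sub, Real.exp_log hu]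
    ring
  rw [ratio, hq]
  field_simp
  linear_combination hrec

lemma ratio_nonneg (hβ : 0 < β) (hV01 : ∀ ω, V ω ∈ Set.Icc (0 : ℝ) 1)
    (hθ : β < freeEnergy P T V β θ) (ω : Ω) : 0 ≤ ratio P T V β θ ω := by
  rw [ratio_eq hβ hV01 hθ]
  exact mul_nonneg (leftFrac_pos hβ hθ.le hV01 _).le (leftFrac_pos hβ hθ.le hV01 _).le

lemma ratio_le_leftFrac (hβ : 0 < β) (hV01 : ∀ ω, V ω ∈ Set.Icc (0 : ℝ) 1)
    (hθ : β < freeEnergy P T V β θ) (ω : Ω) :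
    ratio P T V β θ ω ≤ leftFrac T V β (freeEnergy P T V β θ) ω := by
  rw [ratio_eq hβ hV01 hθ]
  exact mul_le_of_le_one_right (leftFrac_pos hβ hθ.le hV01 _).le (leftFrac_le_one hβ hθ.le hV01 _)

lemma measurable_ratio (hV : Measurable V) (hβ : 0 < β) (hV01 : ∀ ω, V ω ∈ Set.Icc (0 : ℝ) 1)
    (hθ : β < freeEnergy P T V β θ) : Measurable (ratio P T V β θ) := by
  rw [funext (ratio_eq hβ hV01 hθ)]
  exact (measurable_leftFrac hV).mul ((measurable_leftFrac hV).comp (measurable_shift T _))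

lemma ratioProd_eq (n : ℕ) (ω : Ω) :
    ratioProd P T V β θ n ω = ∏ j ∈ Finset.range n, ratio P T V β θ (shift T ((j : ℤ) + 1) ω) := by
  induction n with
  | zero => simp [ratioProd]
  | succ n ih =>
    rw [Finset.prod_range_succ, ← ih, ratioProd, Finset.prod_Icc_succ_top (by omega)]
    push_cast
    rfl

lemma summable_exp_pow (hθ : β < freeEnergy P T V β θ) :
    Summable fun n : ℕ => Real.exp (-(freeEnergy P T V β θ - β)) ^ (n + 1) :=
  (summable_nat_add_iff 1).2 (summable_geometric_of_lt_one (Real.exp_pos _).le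
    (by rw [Real.exp_lt_one_iff]; linarith))

variable (hβ : 0 < β) (hV01 : ∀ ω, V ω ∈ Set.Icc (0 : ℝ) 1) (hθ : β < freeEnergy P T V β θ)

include hβ hV01 hθ

lemma ratioProd_mem (n : ℕ) (ω : Ω) :
    0 ≤ ratioProd P T V β θ n ω ∧
      ratioProd P T V β θ n ω ≤ Real.exp (-(freeEnergy P T V β θ - β)) ^ n := by
  rw [ratioProd_eq]
  refine ⟨Finset.prod_nonneg fun j _ => ratio_nonneg hβ hV01 hθ _, ?_⟩
  simpa using Finset.prod_le_prod (s := Finset.range n)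
    (fun j _ => ratio_nonneg hβ hV01 hθ (shift T ((j : ℤ) + 1) ω))
    fun j _ => (ratio_le_leftFrac hβ hV01 hθ _).trans (leftFrac_le_exp hβ hθ.le hV01 _)

lemma summable_ratioProd (ω : Ω) : Summable fun n : ℕ => ratioProd P T V β θ (n + 1) ω :=
  Summable.of_nonneg_of_le (fun _ => (ratioProd_mem hβ hV01 hθ _ ω).1)
    (fun _ => (ratioProd_mem hβ hV01 hθ _ ω).2) (summable_exp_pow hθ)

/-- The ratio is dominated by `rBar`, whose values along the orbit are independent, so that the
expectation of the series is at most a geometric series. -/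
lemma integrable_ratioSeries_and_integral_le [IsProbabilityMeasure P] (hV : Measurable V)
    (hIndep : iIndepFun (fun (j : ℤ) (ω : Ω) => V (shift T j ω)) P)
    (hIdent : ∀ j : ℤ, IdentDistrib (fun ω => V (shift T j ω)) V P P)
    (hInf : essInf V P = 0) :
    Integrable (fun ω => (1 + ratio P T V β θ ω) * ratioSeries P T V β θ ω) P ∧
    ∫ ω, (1 + ratio P T V β θ ω) * ratioSeries P T V β θ ω ∂P ≤
      (1 + ∫ ω, rBar V β ω ∂P) / (1 - ∫ ω, rBar V β ω ∂P) := by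
  set κ := Real.exp (-(freeEnergy P T V β θ - β)) with hκ
  set D : ℝ := 1 + ∑' n : ℕ, κ ^ (n + 1) with hD
  set G : ℕ → Ω → ℝ := fun N ω => (1 + ratio P T V β θ ω) *
    (1 + ∑ n ∈ Finset.range N, ratioProd P T V β θ (n + 1) ω) with hG
  have hr0 := ratio_nonneg hβ hV01 hθ
  have hrm := measurable_ratio hV hβ hV01 hθ
  have hlim : ∀ ω, Tendsto (fun N => G N ω) atTop
      (𝓝 ((1 + ratio P T V β θ ω) * ratioSeries P T V β θ ω)) := fun ω =>
    ((summable_ratioProd hβ hV01 hθ ω).hasSum.tendsto_sum_nat.const_add 1).const_mul _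
  have hGm : ∀ N, Measurable (G N) := by
    intro N
    refine (hrm.const_add 1).mul ((Finset.measurable_sum _ fun n _ => ?_).const_add 1)
    rw [funext (ratioProd_eq (P := P) (T := T) (V := V) (β := β) (θ := θ) (n + 1))]
    exact Finset.measurable_prod _ fun j _ => hrm.comp (measurable_shift T _)
  have hG0 : ∀ N ω, 0 ≤ G N ω := fun N ω => by
    have h1 := Finset.sum_nonneg fun n (_ : n ∈ Finset.range N) =>
      (ratioProd_mem hβ hV01 hθ (n + 1) ω).1
    exact mul_nonneg (by linarith [hr0 ω]) (by linarith)
  have hGbound : ∀ N ω, ‖G N ω‖ ≤ 2 * D := by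
    intro N ω
    rw [Real.norm_eq_abs, abs_of_nonneg (hG0 N ω)]
    have h1 : ∑ n ∈ Finset.range N, ratioProd P T V β θ (n + 1) ω ≤ ∑' n : ℕ, κ ^ (n + 1) :=
      (Finset.sum_le_sum fun n _ => (ratioProd_mem hβ hV01 hθ (n + 1) ω).2).trans
        ((summable_exp_pow hθ).sum_le_tsum _ fun n _ => by positivity)
    have h2 := (ratio_le_leftFrac hβ hV01 hθ ω).trans (leftFrac_le_one hβ hθ.le hV01 ω)
    have h3 := Finset.sum_nonneg fun n (_ : n ∈ Finset.range N) =>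
      (ratioProd_mem hβ hV01 hθ (n + 1) ω).1
    exact mul_le_mul (by linarith) (by linarith) (by linarith) (by norm_num)
  have hGint : ∀ N, Integrable (G N) P := fun N =>
    Integrable.of_bound (hGm N).aestronglyMeasurable _ (Eventually.of_forall (hGbound N))
  have hmeas : Measurable fun ω => (1 + ratio P T V β θ ω) * ratioSeries P T V β θ ω :=
    measurable_of_tendsto_metrizable hGm (tendsto_pi_nhds.2 hlim)
  refine ⟨Integrable.of_bound hmeas.aestronglyMeasurable (2 * D) (Eventually.of_forall fun ω =>
    le_of_tendsto' (hlim ω).norm fun N => hGbound N ω), ?_⟩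
  refine le_of_tendsto' (tendsto_integral_of_dominated_convergence (fun _ => 2 * D)
    (fun N => (hGm N).aestronglyMeasurable) (integrable_const _)
    (fun N => Eventually.of_forall (hGbound N)) (Eventually.of_forall hlim)) fun N => ?_
  have hip := fun c : ℕ → ℤ => integrable_prod_rBar (P := P) (T := T) hV hβ hV01 c
  refine le_trans (integral_mono (hGint N) (integrable_finsetSum (Finset.range (N + 1)) fun k _ =>
    (hip (fun j => (j : ℤ) + 1) k).add (hip (fun j => (j : ℤ)) (k + 1))) fun ω => ?_)
    (integral_sum_prod_rBar_le hV hIndep hIdent hInf hβ hV01 (c := fun j => (j : ℤ) + 1)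
      (d := fun j => (j : ℤ)) (fun i j h => by simpa using h) (fun i j h => by simpa using h)
      (N + 1))
  have hle : ∀ ω, ratio P T V β θ ω ≤ rBar V β ω := fun ω =>
    (ratio_le_leftFrac hβ hV01 hθ ω).trans (leftFrac_le_rBar hβ hθ.le hV01 ω)
  have hprod : ∀ n, ratioProd P T V β θ n ω ≤
      ∏ j ∈ Finset.range n, rBar V β (shift T ((j : ℤ) + 1) ω) := fun n => by
    rw [ratioProd_eq]
    exact Finset.prod_le_prod (fun j _ => hr0 _) fun j _ => hle _
  have h1 : G N ω = (1 + ratio P T V β θ ω) *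
      ∑ n ∈ Finset.range (N + 1), ratioProd P T V β θ n ω := by
    rw [Finset.sum_range_succ', add_comm (∑ n ∈ _, _)]
    simp [hG, ratioProd]
  rw [h1, Finset.mul_sum]
  refine Finset.sum_le_sum fun k _ => ?_
  simp only [Pi.add_apply]
  rw [Finset.prod_range_succ']
  push_cast
  rw [shift_zero]
  calc (1 + ratio P T V β θ ω) * ratioProd P T V β θ k ω
      ≤ (1 + rBar V β ω) * ∏ j ∈ Finset.range k, rBar V β (shift T ((j : ℤ) + 1) ω) := by
        refine mul_le_mul (by linarith [hle ω]) (hprod k) (ratioProd_mem hβ hV01 hθ k ω).1 ?_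
        linarith [rBar_nonneg (V := V) (β := β) ω]
    _ = _ := by ring

end Ratio

/-! ### The shape of the free energy -/

/-- A function that is constant to the left of `a`, and grows at least linearly to the right of `a`,
is not differentiable at `a`. -/
lemma not_differentiableAt_of_kink {f : ℝ → ℝ} {a b m c : ℝ} (hba : b < a) (hc : 0 < c)
    (hleft : ∀ x ∈ Set.Icc b a, f x = m) (hright : ∀ x, a < x → c * (x - a) ≤ f x - m) :
    ¬ DifferentiableAt ℝ f a := by
  intro hd
  have hfa : f a = m := hleft a ⟨hba.le, le_rfl⟩
  have hs := hasDerivAt_iff_tendsto_slope.1 hd.hasDerivAt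
  have h1 : Tendsto (slope f a) (𝓝[<] a) (𝓝 (deriv f a)) :=
    hs.mono_left (nhdsWithin_mono _ fun x (hx : x < a) => hx.ne)
  have h2 : Tendsto (slope f a) (𝓝[>] a) (𝓝 (deriv f a)) :=
    hs.mono_left (nhdsWithin_mono _ fun x (hx : a < x) => hx.ne')
  have h3 : deriv f a = 0 := by
    refine tendsto_nhds_unique h1 (tendsto_const_nhds.congr' ?_)
    filter_upwards [Ioo_mem_nhdsLT hba] with x hx
    rw [slope_def_field, hleft x ⟨hx.1.le, hx.2.le⟩, hfa, sub_self, zero_div]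
  have h4 : c ≤ deriv f a := by
    refine ge_of_tendsto h2 ?_
    filter_upwards [self_mem_nhdsWithin] with x hx
    have hx' : a < x := hx
    rw [slope_def_field, hfa, le_div_iff₀ (by linarith)]
    exact hright x hx'
  linarith

section Shape

variable {Ω : Type*} [MeasurableSpace Ω] {P : Measure Ω} {T : Ω ≃ᵐ Ω} {V : Ω → ℝ} {β : ℝ}

lemma isTiltedFreeEnergy_of_symm {θ l : ℝ} (h : IsTiltedFreeEnergy P T.symm V β θ l) :
    IsTiltedFreeEnergy P T V β (-θ) l := by
  filter_upwards [h] with ω hω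
  simpa only [partitionFn_symm] using hω

/-- Between two tilts `-t` and `t` at which the free energy takes its minimal value `β`, it is
constant. -/
lemma isTiltedFreeEnergy_of_abs_le {t θ : ℝ} (ht : |θ| ≤ t) (hβ : 0 < β)
    (hstretch : ∀ᵐ ω ∂P, ∀ η > 0, ∀ L : ℕ, ∃ y : ℤ, ∀ x : ℤ, |x - y| < L →
      1 - η ≤ V (shift T x ω))
    (h1 : IsTiltedFreeEnergy P T V β t β) (h2 : IsTiltedFreeEnergy P T V β (-t) β) :
    IsTiltedFreeEnergy P T V β θ β := by
  filter_upwards [hstretch, h1, h2] with ω hω h1 h2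
  refine tendsto_one_div_mul (fun ε hε => ⟨Real.log 2, ?_⟩)
    (fun ε hε => linear_lower_bound_of_stretch hβ hω θ hε)
  filter_upwards [eventually_le_of_tendsto_one_div_mul h1 hε,
    eventually_le_of_tendsto_one_div_mul h2 hε] with n h3 h4
  rw [Real.log_le_iff_le_exp (partitionFn_pos _ _ _)] at h3 h4
  rw [Real.log_le_iff_le_exp (partitionFn_pos _ _ _), Real.exp_add, Real.exp_log two_pos]
  linarith [partitionFn_le_add (T := T) (V := V) (β := β) ht n ω]

lemma exists_growthRate_eq [IsProbabilityMeasure P] (hV : Measurable V)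
    (hIndep : iIndepFun (fun (j : ℤ) (ω : Ω) => V (shift T j ω)) P)
    (hIdent : ∀ j : ℤ, IdentDistrib (fun ω => V (shift T j ω)) V P P)
    (hInf : essInf V P = 0) (hβ : 0 < β) (hV01 : ∀ ω, V ω ∈ Set.Icc (0 : ℝ) 1) {θ : ℝ}
    (hθ : growthRate P T V β β ≤ θ) : ∃ lam, β ≤ lam ∧ growthRate P T V β lam = θ := by
  set K := (1 + ∫ ω, rBar V β ω ∂P) / (1 - ∫ ω, rBar V β ω ∂P) with hK
  have hlip : LipschitzOnWith K.toNNReal (growthRate P T V β) (Set.Ici β) := by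
    refine LipschitzOnWith.of_le_add_mul' _ ?_
    intro x hx y hy
    have hK0 : 0 ≤ K := by
      have h1 := integral_rBar_lt_one hV hβ hV01 hInf
      have h2 : 0 ≤ ∫ ω, rBar V β ω ∂P := integral_nonneg rBar_nonneg
      exact div_nonneg (by linarith) (by linarith)
    rcases le_total x y with hxy | hxy
    · have h1 := growthRate_add_le (P := P) (T := T) hV hβ hx hV01 (sub_nonneg.2 hxy)
      rw [add_sub_cancel] at h1
      have h2 : 0 ≤ K * dist x y := by positivity
      linarith
    · have h1 := growthRate_add_sub_le hV hIndep hIdent hInf hβ hy hV01 (sub_nonneg.2 hxy)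
      rw [add_sub_cancel] at h1
      rw [Real.dist_eq, abs_of_nonneg (sub_nonneg.2 hxy)]
      linarith
  set M := β + (θ - growthRate P T V β β) with hM
  have hβM : β ≤ M := by linarith
  have hcont : ContinuousOn (growthRate P T V β) (Set.Icc β M) :=
    hlip.continuousOn.mono Set.Icc_subset_Ici_self
  have hup := growthRate_add_le (P := P) (T := T) hV hβ le_rfl hV01 (sub_nonneg.2 hθ)
  obtain ⟨lam, hlam, h⟩ := intermediate_value_Icc hβM hcont ⟨hθ, by linarith⟩
  exact ⟨lam, hlam.1, h⟩

end Shape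

end TiltedWalk

end

open TiltedWalk in
theorem propositionD1 {Ω : Type*} [MeasurableSpace Ω]
    (P : Measure Ω) [IsProbabilityMeasure P]
    (T : Ω ≃ᵐ Ω) (hT : Ergodic T P)
    (V : Ω → ℝ) (hV : Measurable V) (hV01 : ∀ ω, V ω ∈ Set.Icc (0 : ℝ) 1)
    (hInf : essInf V P = 0) (hSup : essSup V P = 1)
    (hIndep : iIndepFun (fun (j : ℤ) (ω : Ω) => V (TiltedWalk.shift T j ω)) P)
    (hIdent : ∀ j : ℤ, IdentDistrib (fun ω => V (TiltedWalk.shift T j ω)) V P P)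
    (β : ℝ) (hβ : 0 < β) :
    -- the tilted free energy exists as an almost sure limit, and `θ_b` is well defined
    (∀ θ : ℝ, TiltedWalk.IsTiltedFreeEnergy P T V β θ (TiltedWalk.freeEnergy P T V β θ)) ∧
    IsLUB {θ : ℝ | TiltedWalk.freeEnergy P T V β θ = β} (TiltedWalk.thetaB P T V β) ∧
    IsGLB {θ : ℝ | 0 < θ ∧ β < TiltedWalk.freeEnergy P T V β θ} (TiltedWalk.thetaB P T V β) ∧
    0 < TiltedWalk.thetaB P T V β ∧
    -- the uniform bound
    (∫ ω, TiltedWalk.rBar V β ω ∂P) < 1 ∧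
    (∀ θ : ℝ, TiltedWalk.thetaB P T V β < θ →
      β < TiltedWalk.freeEnergy P T V β θ ∧
      (∀ ω, Summable fun n : ℕ => TiltedWalk.ratioProd P T V β θ (n + 1) ω) ∧
      Integrable
        (fun ω => (1 + TiltedWalk.ratio P T V β θ ω) * TiltedWalk.ratioSeries P T V β θ ω) P ∧
      (∫ ω, (1 + TiltedWalk.ratio P T V β θ ω) * TiltedWalk.ratioSeries P T V β θ ω ∂P) ≤
        (1 + ∫ ω, TiltedWalk.rBar V β ω ∂P) / (1 - ∫ ω, TiltedWalk.rBar V β ω ∂P)) ∧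
    -- nondifferentiability at both endpoints
    ¬ DifferentiableAt ℝ (fun θ : ℝ => TiltedWalk.freeEnergy P T V β θ)
        (TiltedWalk.thetaB P T V β) ∧
    ¬ DifferentiableAt ℝ (fun θ : ℝ => TiltedWalk.freeEnergy P T V β θ)
        (-TiltedWalk.thetaB P T V β) := by
  have hsymm : ∀ lam, growthRate P T.symm V β lam = growthRate P T V β lam := fun lam =>
    growthRate_symm hV hIndep hIdent
  set t := growthRate P T V β β with ht
  have ht0 : 0 < t := growthRate_pos hV hInf hβ hV01
  have hright : ∀ lam, β ≤ lam → IsTiltedFreeEnergy P T V β (growthRate P T V β lam) lam :=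
    fun lam hlam => isTiltedFreeEnergy_growthRate hT hV hβ hlam hV01
  have hleft : ∀ lam, β ≤ lam → IsTiltedFreeEnergy P T V β (-growthRate P T V β lam) lam :=
    fun lam hlam => by
      have h := isTiltedFreeEnergy_growthRate (T := T.symm) hT.symm hV hβ hlam hV01
      rw [hsymm] at h
      exact isTiltedFreeEnergy_of_symm h
  have hmid : ∀ θ, |θ| ≤ t → IsTiltedFreeEnergy P T V β θ β := fun θ hθ =>
    isTiltedFreeEnergy_of_abs_le hθ hβ (ae_exists_stretch hV hIndep hIdent hT hV01 hSup)
      (hright β le_rfl) (hleft β le_rfl)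
  have hout : ∀ θ, t ≤ θ → ∃ lam, β ≤ lam ∧ growthRate P T V β lam = θ := fun θ hθ =>
    exists_growthRate_eq hV hIndep hIdent hInf hβ hV01 hθ
  have heven : ∀ θ, ∃ l, IsTiltedFreeEnergy P T V β θ l ∧ IsTiltedFreeEnergy P T V β (-θ) l := by
    intro θ
    rcases le_total |θ| t with h | h
    · exact ⟨β, hmid θ h, hmid (-θ) (by rwa [abs_neg])⟩
    · obtain ⟨lam, hlam, hg⟩ := hout |θ| h
      have h1 := hright lam hlam
      have h2 := hleft lam hlam
      rw [hg] at h1 h2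
      rcases abs_choice θ with h3 | h3 <;> rw [h3] at h1 h2
      · exact ⟨lam, h1, h2⟩
      · exact ⟨lam, by rwa [neg_neg] at h2, h1⟩
  have hfe_mid : ∀ θ, |θ| ≤ t → freeEnergy P T V β θ = β := fun θ hθ => freeEnergy_eq (hmid θ hθ)
  have hfe_neg : ∀ θ, freeEnergy P T V β (-θ) = freeEnergy P T V β θ := fun θ => by
    obtain ⟨l, h1, h2⟩ := heven θ
    rw [freeEnergy_eq h1, freeEnergy_eq h2]
  have hρ1 := integral_rBar_lt_one (P := P) hV hβ hV01 hInf
  have hρ0 : 0 ≤ ∫ ω, rBar V β ω ∂P := integral_nonneg rBar_nonneg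
  set K := (1 + ∫ ω, rBar V β ω ∂P) / (1 - ∫ ω, rBar V β ω ∂P) with hK
  have hK0 : 0 < K := div_pos (by linarith) (by linarith)
  have hslope : ∀ θ, t < θ → K⁻¹ * (θ - t) ≤ freeEnergy P T V β θ - β := by
    intro θ hθ
    obtain ⟨lam, hlam, hg⟩ := hout θ hθ.le
    have h1 := growthRate_add_sub_le hV hIndep hIdent hInf hβ le_rfl hV01 (sub_nonneg.2 hlam)
    rw [add_sub_cancel, hg] at h1
    have h2 := hright lam hlam
    rw [hg] at h2
    rw [freeEnergy_eq h2, inv_mul_le_iff₀ hK0, mul_comm K]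
    exact h1
  have hfe_gt : ∀ θ, t < θ → β < freeEnergy P T V β θ := fun θ hθ => by
    have h1 : 0 < K⁻¹ * (θ - t) := mul_pos (inv_pos.2 hK0) (by linarith)
    linarith [hslope θ hθ]
  have hset : {θ : ℝ | freeEnergy P T V β θ = β} = Set.Icc (-t) t := by
    ext θ
    rw [Set.mem_ofPred_eq, Set.mem_Icc, ← abs_le]
    refine ⟨fun h => ?_, hfe_mid θ⟩
    by_contra! hlt
    have h1 := hfe_gt _ hlt
    rcases abs_choice θ with h2 | h2 <;> rw [h2] at h1
    · linarith
    · rw [hfe_neg] at h1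
      linarith
  have hthetaB : thetaB P T V β = t := by
    rw [thetaB, hset, csSup_Icc (by linarith)]
  have hset' : {θ : ℝ | 0 < θ ∧ β < freeEnergy P T V β θ} = Set.Ioi t := by
    ext θ
    refine ⟨fun h => ?_, fun h => ⟨ht0.trans h, hfe_gt θ h⟩⟩
    by_contra hle
    have h1 := hfe_mid θ (by rw [abs_of_pos h.1]; exact not_lt.1 hle)
    linarith [h.2]
  have hkink : ¬ DifferentiableAt ℝ (fun θ => freeEnergy P T V β θ) t :=
    not_differentiableAt_of_kink (b := 0) (m := β) ht0 (inv_pos.2 hK0)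
      (fun θ hθ => hfe_mid θ (by rw [abs_of_nonneg hθ.1]; exact hθ.2)) hslope
  rw [hthetaB, hset, hset']
  refine ⟨fun θ => ?_, isLUB_Icc (by linarith), isGLB_Ioi, ht0, hρ1, fun θ hθ => ?_, hkink, ?_⟩
  · obtain ⟨l, h1, -⟩ := heven θ
    rwa [freeEnergy_eq h1]
  · exact ⟨hfe_gt θ hθ, summable_ratioProd hβ hV01 (hfe_gt θ hθ),
      integrable_ratioSeries_and_integral_le hβ hV01 (hfe_gt θ hθ) hV hIndep hIdent hInf⟩
  · -- The free energy is even, so the kink at `t` is mirrored at `-t`.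
    intro hd
    have h1 := hd.comp t (f := fun θ : ℝ => -θ) differentiableAt_id.neg
    have h2 : (fun θ => freeEnergy P T V β θ) ∘ (fun θ : ℝ => -θ) =
        fun θ => freeEnergy P T V β θ := funext hfe_neg
    rw [h2] at h1
    exact hkink h1
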